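/- There is a unique continuous function $y:[0,\infty)\to[0,\infty)$ with $y(0)=0$ that is differentiable on $(0,\infty)$ and satisfies there $$y'(r)=1-\Bigl(1+\frac{2}{r^2}\Bigr)y(r)^2 .$$ It is a bijection from $[0,\infty)$ onto $[0,1)$, and its inverse $\varphi:[0,1)\to[0,\infty)$ is continuous and strictly increasing, with $\varphi(0)=0$ and $\lim_{\delta\to1^-}\varphi(\delta)=\infty$. Let $\delta\in[0,1)$. Let $D$ be the open unit disk of $\mathbb R^2$ and let $q$ be a smooth Riemannian metric on $D$ such that $(D,q)$ is a Riemannian disk of center $c_0\in D$ and radius $\varphi(\delta)$: for the Riemannian distance $d$ of $q$, every $x\in D$ satisfies $d(c_0,x)<\varphi(\delta)$, and for every $r<\varphi(\delta)$ the closed ball $\{x\in D: d(c_0,x)\le r\}$ is compact. Suppose that the Gauss curvature $K_q$ takes its values in $[-1,0]$, and let $u:D\to\mathbb R$ be a smooth function with $\Delta_q u=1$ on $D$, where $\Delta_q$ is the Laplace–Beltrami operator (the trace of the Hessian). Then there is a point $x\in D$ with $\|du\|_q(x)\ge\delta$. -/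

import Mathlib

open Set Filter Topology
open scoped ContDiff

namespace RDisk

noncomputable section

/-- The Euclidean plane, in whose coordinates everything is written. -/
abbrev Plane := EuclideanSpace ℝ (Fin 2)

/-- The underlying smooth disk: the open unit disk of the plane. -/
def disk : Set Plane := Metric.ball 0 1

/-- The partial derivative `∂ᵢ f`. -/
def pd (i : Fin 2) (f : Plane → ℝ) (x : Plane) : ℝ :=
  fderiv ℝ f x (EuclideanSpace.single i 1)

/-- `q` is a smooth Riemannian metric on the disk: `q x i j = q(∂ᵢ, ∂ⱼ)` at the point `x`
(positive definite matrices are symmetric). Values of `q` outside the disk play no role. -/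
structure IsRiemannianMetric (q : Plane → Matrix (Fin 2) (Fin 2) ℝ) : Prop where
  smooth : ∀ i j, ContDiffOn ℝ ∞ (fun x => q x i j) disk
  posDef : ∀ x ∈ disk, (q x).PosDef

/-- The Christoffel symbols `Γᵏᵢⱼ` of the Levi-Civita connection of `q`. -/
def christoffel (q : Plane → Matrix (Fin 2) (Fin 2) ℝ) (k i j : Fin 2) (x : Plane) : ℝ :=
  (1 / 2) * ∑ l, (q x)⁻¹ k l *
    (pd i (fun z => q z j l) x + pd j (fun z => q z i l) x - pd l (fun z => q z i j) x)

/-- The component along `∂ₗ` of the curvature tensor `R(∂ᵢ, ∂ⱼ)∂ₖ`, where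
`R(X, Y)Z = ∇_X ∇_Y Z - ∇_Y ∇_X Z - ∇_[X,Y] Z`. -/
def riemannTensor (q : Plane → Matrix (Fin 2) (Fin 2) ℝ) (l i j k : Fin 2) (x : Plane) : ℝ :=
  pd i (christoffel q l j k) x - pd j (christoffel q l i k) x
    + ∑ m, (christoffel q l i m x * christoffel q m j k x
      - christoffel q l j m x * christoffel q m i k x)

/-- The Gauss curvature `K = q(R(∂₀, ∂₁)∂₁, ∂₀) / det q`. -/
def gaussCurvature (q : Plane → Matrix (Fin 2) (Fin 2) ℝ) (x : Plane) : ℝ :=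
  (∑ l, q x 0 l * riemannTensor q l 0 1 1 x) / (q x).det

/-- The Laplace-Beltrami operator `Δu = tr_q ∇du = qⁱʲ (∂ᵢ∂ⱼu - Γᵏᵢⱼ ∂ₖu)`
(the sign is such that it is `∂₀² + ∂₁²` for the Euclidean metric). -/
def laplacian (q : Plane → Matrix (Fin 2) (Fin 2) ℝ) (u : Plane → ℝ) (x : Plane) : ℝ :=
  ∑ i, ∑ j, (q x)⁻¹ i j * (pd i (pd j u) x - ∑ k, christoffel q k i j x * pd k u x)

/-- The norm `‖du‖_q = √(qⁱʲ ∂ᵢu ∂ⱼu)` of the differential of `u`. -/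
def normDiff (q : Plane → Matrix (Fin 2) (Fin 2) ℝ) (u : Plane → ℝ) (x : Plane) : ℝ :=
  Real.sqrt (∑ i, ∑ j, (q x)⁻¹ i j * pd i u x * pd j u x)

/-- The length for `q` of the curve `γ`, parametrised by `[0, 1]`. -/
def curveLength (q : Plane → Matrix (Fin 2) (Fin 2) ℝ) (γ : ℝ → Plane) : ℝ :=
  ∫ t in (0 : ℝ)..1, Real.sqrt (∑ i, ∑ j, q (γ t) i j * deriv γ t i * deriv γ t j)

/-- The Riemannian distance of the disk with the metric `q`: the infimum of the lengths of the
`C¹` curves in the disk that join `x` to `y` (for `x`, `y` in the disk there are such curves). -/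
def riemDist (q : Plane → Matrix (Fin 2) (Fin 2) ℝ) (x y : Plane) : ℝ :=
  sInf {ℓ : ℝ | ∃ γ : ℝ → Plane, ContDiff ℝ 1 γ ∧ (∀ t ∈ Icc (0 : ℝ) 1, γ t ∈ disk) ∧
    γ 0 = x ∧ γ 1 = y ∧ ℓ = curveLength q γ}

/-- The disk with the metric `q` is a Riemannian disk of center `c` and radius `R`: it is the open
ball of center `c` and radius `R` for its Riemannian distance, and the closed balls of center `c`
and smaller radius are compact. (Without the compactness, the boundary could be reached from `c`
before the distance `R`; with it, the boundary lies at distance exactly `R` from `c`.) -/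
structure IsDiskOfRadius (q : Plane → Matrix (Fin 2) (Fin 2) ℝ) (c : Plane) (R : ℝ) : Prop where
  center_mem : c ∈ disk
  dist_lt : ∀ x ∈ disk, riemDist q c x < R
  isCompact_closedBall : ∀ r < R, IsCompact {x ∈ disk | riemDist q c x ≤ r}

/-- `y` is on `[0, ∞)` a nonnegative solution, vanishing at `0`, of the Riccati equation
`y' = 1 - (1 + 2 / r²) y²`. The equation is singular at `0`, and infinitely many solutions that
vanish at `0` are negative for small `r > 0`, hence the condition on the sign. -/
structure IsRiccatiSolution (y : ℝ → ℝ) : Prop where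
  zero : y 0 = 0
  continuousOn : ContinuousOn y (Ici 0)
  nonneg : ∀ r, 0 < r → 0 ≤ y r
  ode : ∀ r, 0 < r → HasDerivAt y (1 - (1 + 2 / r ^ 2) * y r ^ 2) r

end

end RDisk

/-! The gradient is bounded below through its flux. Let `L r` be the length of the geodesic circle
of radius `r` about the center and `A r` the flux of the gradient of `u` through it. Since the
Laplacian is `1`, the divergence theorem gives `A' = L`, so `A` is the area. If the gradient were
everywhere shorter than `y R`, with `R` the radius, then `A ≤ y R * L` would hold on all circles,
and it is enough to refute this isoperimetric inequality.

The length element `J` solves the Jacobi equation `J'' = -K J` with `J = 0`, `J' = 1` at the center.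
From `K ≤ 0` follows `J' ≥ 1`, hence `L' ≥ 2π` and `A ≥ π r²`. From `K ≥ -1` follows `L'' ≤ L = A'`,
hence `L' ≤ 2π + A ≤ (1 + 2 / r²) A`. So `Y = A / L` satisfies `Y' = 1 - A L' / L² ≥ 1 - (1 + 2 /
r²) Y²`, and comparison gives `Y ≥ y`. All these inequalities cannot be equalities at once, and a
margin once gained decays at most exponentially, so `Y ≤ y R` fails before the radius `R`. This is
`exists_lt_area_div_length`.

The geometry enters through the exponential map alone, and injectivity plays no role: the divergence
theorem is used in the variables `(θ, t)`, as the vanishing of the integral over a period of the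
`θ`-derivative of `du` on the unit normal. A unit speed geodesic at time `t` is within distance `t`
of the center, hence in a compact ball when `t < R`; therefore it exists up to time `R`
(`exists_geodesic`), and no minimizing property is needed. The `θ`-derivative of the pencil is the
normal Jacobi field because that field solves the linearized geodesic equation
(`hasDerivWithinAt_jacobi`, `hasDerivAt_isSol_param`). The estimate is assembled in
`exists_le_normDiff`. -/

namespace RDisk

/-! ### Comparison of solutions of first order differential inequalities -/

/-- If `w' ≥ 0` wherever `w < 0` and `w` tends to `0` at `0`, then `w` is nonnegative. -/
lemma nonneg_of_deriv_nonneg_of_neg {w w' : ℝ → ℝ} {b : ℝ}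
    (hw : ∀ r ∈ Ioo 0 b, HasDerivAt w (w' r) r)
    (h : ∀ r ∈ Ioo 0 b, w r < 0 → 0 ≤ w' r)
    (h0 : Tendsto w (𝓝[>] 0) (𝓝 0)) : ∀ r ∈ Ioo 0 b, 0 ≤ w r := by
  intro r₁ hr₁
  by_contra! hneg
  obtain ⟨r₀, hr₀, hr₀₁⟩ : ∃ r₀, w r₁ / 2 < w r₀ ∧ r₀ ∈ Ioo 0 r₁ :=
    ((h0.eventually (lt_mem_nhds (by linarith : w r₁ / 2 < 0))).and
      (Ioo_mem_nhdsGT hr₁.1)).exists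
  have hsub : ∀ r ∈ Icc r₀ r₁, r ∈ Ioo 0 b := fun r hr =>
    ⟨hr₀₁.1.trans_le hr.1, hr.2.trans_lt hr₁.2⟩
  have hcont : ContinuousOn w (Icc r₀ r₁) := fun r hr =>
    (hw r (hsub r hr)).continuousAt.continuousWithinAt
  have hcomp : IsCompact (Icc r₀ r₁ ∩ w ⁻¹' Ici (w r₁ / 2)) :=
    isCompact_Icc.of_isClosed_subset
      (hcont.preimage_isClosed_of_isClosed isClosed_Icc isClosed_Ici) inter_subset_left
  -- `s` is the last time in `[r₀, r₁]` with `w ≥ w r₁ / 2`. After `s` the function is negative,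
  -- hence nondecreasing, so `w r₁ ≥ w s ≥ w r₁ / 2 > w r₁`.
  obtain ⟨s, ⟨hs, hsw⟩, hmax⟩ :=
    hcomp.exists_isGreatest ⟨r₀, ⟨le_rfl, hr₀₁.2.le⟩, hr₀.le⟩
  have hmono : MonotoneOn w (Icc s r₁) := by
    refine monotoneOn_of_deriv_nonneg (convex_Icc _ _)
      (hcont.mono (Icc_subset_Icc hs.1 le_rfl)) ?_ ?_
    · intro r hr
      rw [interior_Icc] at hr
      exact (hw r (hsub r ⟨hs.1.trans hr.1.le, hr.2.le⟩)).differentiableAt.differentiableWithinAt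
    · intro r hr
      rw [interior_Icc] at hr
      have hr' := hsub r ⟨hs.1.trans hr.1.le, hr.2.le⟩
      rw [(hw r hr').deriv]
      refine h r hr' ?_
      by_contra! hc
      have := hmax ⟨⟨hs.1.trans hr.1.le, hr.2.le⟩, show w r₁ / 2 ≤ w r by linarith⟩
      linarith [hr.1]
  have h1 := hmono ⟨le_rfl, hs.2⟩ ⟨hs.2, le_rfl⟩ hs.2
  have h2 : w r₁ / 2 ≤ w s := hsw
  linarith

/-- A nonnegative solution of the Riccati equation lies below every nonnegative supersolution. -/
lemma riccati_le {y z z' : ℝ → ℝ} {b : ℝ}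
    (hy : ∀ r ∈ Ioo 0 b, HasDerivAt y (1 - (1 + 2 / r ^ 2) * y r ^ 2) r)
    (hz : ∀ r ∈ Ioo 0 b, HasDerivAt z (z' r) r)
    (hz' : ∀ r ∈ Ioo 0 b, 1 - (1 + 2 / r ^ 2) * z r ^ 2 ≤ z' r)
    (hz0 : ∀ r ∈ Ioo 0 b, 0 ≤ z r)
    (hyl : Tendsto y (𝓝[>] 0) (𝓝 0)) (hzl : Tendsto z (𝓝[>] 0) (𝓝 0)) :
    ∀ r ∈ Ioo 0 b, y r ≤ z r := by
  intro r hr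
  -- Where `z < y`, the sign of `z` gives `z² ≤ y²` and so `z' ≥ y'`. Only signs are used, hence the
  -- singular coefficient at `0` does no harm.
  have := nonneg_of_deriv_nonneg_of_neg (w := fun r => z r - y r)
    (fun r hr => (hz r hr).sub (hy r hr)) (fun r hr hneg => ?_)
    (by simpa using hzl.sub hyl) r hr
  · simpa using this
  · have h1 := hz' r hr
    have h2 : z r ^ 2 ≤ y r ^ 2 := by
      have := hz0 r hr
      gcongr
      linarith
    have h3 : (1 + 2 / r ^ 2) * z r ^ 2 ≤ (1 + 2 / r ^ 2) * y r ^ 2 := by gcongr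
    linarith

lemma pos_of_hasDerivAt_pos {f f' : ℝ → ℝ} (h0 : f 0 = 0) (hf : ∀ x, HasDerivAt f (f' x) x)
    (hpos : ∀ x, 0 < x → 0 < f' x) {r : ℝ} (hr : 0 < r) : 0 < f r := by
  have : StrictMonoOn f (Ici 0) := by
    refine strictMonoOn_of_deriv_pos (convex_Ici 0)
      (fun x _ => (hf x).continuousAt.continuousWithinAt) ?_
    intro x hx
    rw [interior_Ici] at hx
    rw [(hf x).deriv]
    exact hpos x hx
  rw [← h0]
  exact this self_mem_Ici hr.le hr

/-! ### The solution of the Riccati equation -/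

lemma sinh_lt_mul_cosh {r : ℝ} (hr : 0 < r) : Real.sinh r < r * Real.cosh r := by
  have := pos_of_hasDerivAt_pos (f := fun r => r * Real.cosh r - Real.sinh r)
    (f' := fun r => r * Real.sinh r) (by simp)
    (fun x => (((hasDerivAt_id x).mul (Real.hasDerivAt_cosh x)).sub
      (Real.hasDerivAt_sinh x)).congr_deriv (by simp))
    (fun x hx => mul_pos hx (Real.sinh_pos_iff.2 hx)) hr
  simpa using this

/-- The denominator of the solution of the Riccati equation. -/
noncomputable def riccatiDen (r : ℝ) : ℝ := (r ^ 2 + 1) * Real.sinh r - r * Real.cosh r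

lemma hasDerivAt_riccatiDen (r : ℝ) :
    HasDerivAt riccatiDen (r * Real.sinh r + r ^ 2 * Real.cosh r) r :=
  (((((hasDerivAt_id r).pow 2).add_const 1).mul (Real.hasDerivAt_sinh r)).sub
    ((hasDerivAt_id r).mul (Real.hasDerivAt_cosh r))).congr_deriv (by simp; ring)

lemma riccatiDen_pos {r : ℝ} (hr : 0 < r) : 0 < riccatiDen r :=
  pos_of_hasDerivAt_pos (by simp [riccatiDen]) hasDerivAt_riccatiDen
    (fun x hx => by
      have := Real.sinh_pos_iff.2 hx
      have := Real.cosh_pos x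
      positivity) hr

/-- The solution of the Riccati equation. -/
noncomputable def riccatiSol (r : ℝ) : ℝ :=
  (r ^ 2 * Real.cosh r - r * Real.sinh r) / riccatiDen r

lemma riccatiSol_pos {r : ℝ} (hr : 0 < r) : 0 < riccatiSol r := by
  refine div_pos ?_ (riccatiDen_pos hr)
  have := mul_lt_mul_of_pos_left (sinh_lt_mul_cosh hr) hr
  nlinarith

/-- This provides the limit at `0`, where the quotient is `0 / 0`. Clearing the denominator leaves
`r * ((r² + 2) sinh r - 2 r cosh r) > 0`, whose second factor has derivative `r² cosh r`. -/
lemma riccatiSol_lt_self {r : ℝ} (hr : 0 < r) : riccatiSol r < r := by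
  rw [riccatiSol, div_lt_iff₀ (riccatiDen_pos hr), riccatiDen]
  have := pos_of_hasDerivAt_pos (f := fun r => (r ^ 2 + 2) * Real.sinh r - 2 * r * Real.cosh r)
    (f' := fun r => r ^ 2 * Real.cosh r) (by simp)
    (fun x => (((((hasDerivAt_id x).pow 2).add_const 2).mul (Real.hasDerivAt_sinh x)).sub
      (((hasDerivAt_id x).const_mul 2).mul (Real.hasDerivAt_cosh x))).congr_deriv
        (by simp; ring))
    (fun x hx => by have := Real.cosh_pos x; positivity) hr
  have := mul_pos hr this
  nlinarith

/-- The quotient is `w / w'` for `w = cosh r - sinh r / r`, the solution of `w'' = (1 + 2 / r²) w`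
regular at `0`; and `(w / w')' = 1 - (w'' / w) (w / w')²`. -/
lemma hasDerivAt_riccatiSol {r : ℝ} (hr : 0 < r) :
    HasDerivAt riccatiSol (1 - (1 + 2 / r ^ 2) * riccatiSol r ^ 2) r := by
  have hD := (riccatiDen_pos hr).ne'
  refine ((((((hasDerivAt_id r).pow 2).mul (Real.hasDerivAt_cosh r)).sub
    ((hasDerivAt_id r).mul (Real.hasDerivAt_sinh r))).div
      (hasDerivAt_riccatiDen r) hD)).congr_deriv ?_
  unfold riccatiSol
  field_simp
  simp only [riccatiDen, id, Pi.pow_apply, Pi.mul_apply, Pi.sub_apply]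
  norm_num
  ring

lemma riccatiSol_zero : riccatiSol 0 = 0 := by simp [riccatiSol]

lemma isRiccatiSolution_riccatiSol : IsRiccatiSolution riccatiSol where
  zero := riccatiSol_zero
  continuousOn := by
    intro r hr
    rcases eq_or_lt_of_le (show (0 : ℝ) ≤ r from hr) with rfl | hr
    · rw [ContinuousWithinAt, riccatiSol_zero]
      refine tendsto_of_tendsto_of_tendsto_of_le_of_le' tendsto_const_nhds
        (tendsto_id.mono_left nhdsWithin_le_nhds : Tendsto id (𝓝[≥] (0 : ℝ)) (𝓝 0)) ?_ ?_
      all_goals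
        filter_upwards [self_mem_nhdsWithin] with r hr
        rcases eq_or_lt_of_le (show (0 : ℝ) ≤ r from hr) with rfl | hr
        · simp [riccatiSol_zero]
      · exact (riccatiSol_pos hr).le
      · exact (riccatiSol_lt_self hr).le
    · exact (hasDerivAt_riccatiSol hr).continuousAt.continuousWithinAt
  nonneg r hr := (riccatiSol_pos hr).le
  ode r hr := hasDerivAt_riccatiSol hr

lemma IsRiccatiSolution.tendsto_zero {y : ℝ → ℝ} (hy : IsRiccatiSolution y) :
    Tendsto y (𝓝[>] 0) (𝓝 0) := by
  have := (hy.continuousOn 0 self_mem_Ici).mono Ioi_subset_Ici_self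
  rwa [ContinuousWithinAt, hy.zero] at this

/-- Each solution is a nonnegative supersolution, so `riccati_le` applies both ways. -/
lemma IsRiccatiSolution.eqOn {y z : ℝ → ℝ} (hy : IsRiccatiSolution y)
    (hz : IsRiccatiSolution z) : EqOn z y (Ici 0) := by
  intro r hr
  rcases eq_or_lt_of_le (show (0 : ℝ) ≤ r from hr) with rfl | hr
  · rw [hy.zero, hz.zero]
  · have key : ∀ y z : ℝ → ℝ, IsRiccatiSolution y → IsRiccatiSolution z → y r ≤ z r :=
      fun y z hy hz => riccati_le (b := r + 1) (fun s hs => hy.ode s hs.1)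
        (fun s hs => hz.ode s hs.1) (fun s _ => le_rfl)
        (fun s hs => hz.nonneg s hs.1) hy.tendsto_zero hz.tendsto_zero r ⟨hr, by linarith⟩
    exact le_antisymm (key _ _ hz hy) (key _ _ hy hz)

/-- The solution stays below the curve where the right-hand side of the equation vanishes. -/
lemma riccatiSol_le {r : ℝ} (hr : 0 < r) : riccatiSol r ≤ r / √(r ^ 2 + 2) := by
  have hd : ∀ s : ℝ, HasDerivAt (fun s => s / √(s ^ 2 + 2))
      (2 / ((s ^ 2 + 2) * √(s ^ 2 + 2))) s := by
    intro s
    have hs : 0 < s ^ 2 + 2 := by positivity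
    have hq : 0 < √(s ^ 2 + 2) := Real.sqrt_pos.2 hs
    refine ((hasDerivAt_id s).div ((((hasDerivAt_id s).pow 2).add_const 2).sqrt hs.ne')
      hq.ne').congr_deriv ?_
    have h2 : √(s ^ 2 + 2) ^ 2 = s ^ 2 + 2 := Real.sq_sqrt hs.le
    simp only [id, Pi.pow_apply]
    field_simp
    rw [h2]
    norm_num
    ring
  -- The right-hand side of the equation vanishes along `s / √(s² + 2)`, which is increasing and so
  -- a supersolution.
  refine riccati_le (b := r + 1) (fun s hs => hasDerivAt_riccatiSol hs.1) (fun s _ => hd s)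
    (fun s hs => ?_) (fun s hs => ?_)
    isRiccatiSolution_riccatiSol.tendsto_zero ?_ r ⟨hr, by linarith⟩
  · have h1 : (1 + 2 / s ^ 2) * (s / √(s ^ 2 + 2)) ^ 2 = 1 := by
      have := hs.1
      rw [div_pow, Real.sq_sqrt (by positivity)]
      field_simp
    rw [h1, sub_self]
    positivity
  · have := hs.1
    positivity
  · have := (hd 0).continuousAt.tendsto
    simp only [zero_div] at this
    exact this.mono_left nhdsWithin_le_nhds

lemma riccatiSol_deriv_nonneg {r : ℝ} (hr : 0 < r) :
    0 ≤ 1 - (1 + 2 / r ^ 2) * riccatiSol r ^ 2 := by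
  have h1 : (1 + 2 / r ^ 2) * (r / √(r ^ 2 + 2)) ^ 2 = 1 := by
    rw [div_pow, Real.sq_sqrt (by positivity)]
    field_simp
  have h2 : riccatiSol r ^ 2 ≤ (r / √(r ^ 2 + 2)) ^ 2 :=
    pow_le_pow_left₀ (riccatiSol_pos hr).le (riccatiSol_le hr) 2
  have h3 : (1 + 2 / r ^ 2) * riccatiSol r ^ 2 ≤ (1 + 2 / r ^ 2) * (r / √(r ^ 2 + 2)) ^ 2 := by
    gcongr
  linarith

/-- A zero of `y' ≥ 0` would be a minimum of `y'`, so `y''` would vanish there. But where `y' = 0`,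
differentiating the equation leaves `y'' = 4 y² / r³ > 0`. -/
lemma riccatiSol_deriv_pos {r : ℝ} (hr : 0 < r) :
    0 < 1 - (1 + 2 / r ^ 2) * riccatiSol r ^ 2 := by
  refine lt_of_le_of_ne (riccatiSol_deriv_nonneg hr) fun h => ?_
  have hmin : IsLocalMin (fun r => 1 - (1 + 2 / r ^ 2) * riccatiSol r ^ 2) r := by
    filter_upwards [lt_mem_nhds hr] with s hs
    rw [← h]
    exact riccatiSol_deriv_nonneg hs
  have hd : HasDerivAt (fun r => 1 - (1 + 2 / r ^ 2) * riccatiSol r ^ 2)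
      (4 / r ^ 3 * riccatiSol r ^ 2) r := by
    refine ((((((hasDerivAt_id r).pow 2).inv (by simpa using hr.ne')).const_mul 2).const_add
      1).mul ((hasDerivAt_riccatiSol hr).pow 2)).const_sub 1 |>.congr_deriv ?_
    rw [← h]
    simp only [id, Pi.pow_apply]
    field_simp
    ring
  have := hmin.hasDerivAt_eq_zero hd
  have h4 : 0 < 4 / r ^ 3 * riccatiSol r ^ 2 := by
    have := riccatiSol_pos hr
    positivity
  exact h4.ne' this

lemma strictMonoOn_riccatiSol : StrictMonoOn riccatiSol (Ici 0) := by
  refine strictMonoOn_of_deriv_pos (convex_Ici 0) isRiccatiSolution_riccatiSol.continuousOn ?_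
  intro r hr
  rw [interior_Ici] at hr
  rw [(hasDerivAt_riccatiSol hr).deriv]
  exact riccatiSol_deriv_pos hr

lemma riccatiSol_lt_one {r : ℝ} (hr : 0 ≤ r) : riccatiSol r < 1 := by
  rcases hr.eq_or_lt with rfl | hr
  · simp [riccatiSol_zero]
  · refine (riccatiSol_le hr).trans_lt ?_
    rw [div_lt_one (by positivity)]
    exact Real.lt_sqrt_of_sq_lt (by linarith)

lemma riccatiSol_nonneg {r : ℝ} (hr : 0 ≤ r) : 0 ≤ riccatiSol r := by
  rcases hr.eq_or_lt with rfl | hr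
  · simp [riccatiSol_zero]
  · exact (riccatiSol_pos hr).le

lemma tendsto_riccatiSol_atTop : Tendsto riccatiSol atTop (𝓝 1) := by
  have h1 : Tendsto (fun r : ℝ => 1 - 2 / r) atTop (𝓝 1) := by
    simpa using (tendsto_const_nhds (x := (1 : ℝ))).sub
      (tendsto_const_nhds (x := (2 : ℝ)).div_atTop tendsto_id)
  refine tendsto_of_tendsto_of_tendsto_of_le_of_le' h1 tendsto_const_nhds ?_ ?_
  · filter_upwards [eventually_gt_atTop 2] with r hr
    have hr0 : 0 < r := by linarith
    rw [riccatiSol, le_div_iff₀ (riccatiDen_pos hr0), riccatiDen]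
    have hs := Real.sinh_pos_iff.2 hr0
    have hc : Real.sinh r < Real.cosh r := Real.sinh_lt_cosh r
    have h2 : (1 - 2 / r) = (r - 2) / r := by field_simp
    rw [h2, div_mul_eq_mul_div, div_le_iff₀ hr0]
    nlinarith [mul_pos hr0 hr0, mul_pos (mul_pos hr0 hr0) hr0, mul_pos hs hr0,
      mul_pos (mul_pos hr0 hr0) hs,
      mul_pos (mul_pos (mul_pos hr0 hr0) hr0) (sub_pos.2 hc),
      mul_pos (mul_pos hr0 hr0) (sub_pos.2 hc),
      mul_pos hr0 (sub_pos.2 hc), mul_pos (mul_pos hr0 hs) (sub_pos.2 hr)]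
  · filter_upwards [eventually_gt_atTop 0] with r hr
    exact (riccatiSol_lt_one hr.le).le

lemma image_riccatiSol : riccatiSol '' Ici 0 = Ico 0 1 := by
  apply Subset.antisymm
  · rintro _ ⟨r, hr, rfl⟩
    exact ⟨riccatiSol_nonneg hr, riccatiSol_lt_one hr⟩
  · intro δ hδ
    obtain ⟨M, hM, hM0⟩ := ((tendsto_riccatiSol_atTop.eventually (lt_mem_nhds hδ.2)).and
      (eventually_ge_atTop 0)).exists
    obtain ⟨r, hr, h⟩ := intermediate_value_Icc hM0
      (isRiccatiSolution_riccatiSol.continuousOn.mono Icc_subset_Ici_self)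
      ⟨riccatiSol_zero.trans_le hδ.1, hM.le⟩
    exact ⟨r, hr.1, h⟩

/-- The inverse of the solution of the Riccati equation. -/
noncomputable def riccatiInv : ℝ → ℝ := Function.invFunOn riccatiSol (Ici 0)

lemma riccatiInv_mem {δ : ℝ} (hδ : δ ∈ Ico (0 : ℝ) 1) : riccatiInv δ ∈ Ici (0 : ℝ) :=
  Function.invFunOn_mem (image_riccatiSol ▸ hδ : δ ∈ riccatiSol '' Ici 0)

lemma riccatiSol_riccatiInv {δ : ℝ} (hδ : δ ∈ Ico (0 : ℝ) 1) : riccatiSol (riccatiInv δ) = δ :=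
  Function.invFunOn_eq (image_riccatiSol ▸ hδ : δ ∈ riccatiSol '' Ici 0)

lemma invOn_riccatiInv : InvOn riccatiInv riccatiSol (Ici 0) (Ico 0 1) :=
  ⟨strictMonoOn_riccatiSol.injOn.leftInvOn_invFunOn, fun _ hδ => riccatiSol_riccatiInv hδ⟩

lemma strictMonoOn_riccatiInv : StrictMonoOn riccatiInv (Ico 0 1) := by
  intro a ha b hb hab
  rw [← strictMonoOn_riccatiSol.lt_iff_lt (riccatiInv_mem ha) (riccatiInv_mem hb),
    riccatiSol_riccatiInv ha, riccatiSol_riccatiInv hb]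
  exact hab

lemma riccatiInv_zero : riccatiInv 0 = 0 := by
  have := invOn_riccatiInv.1 (show (0 : ℝ) ∈ Ici 0 from self_mem_Ici)
  rwa [riccatiSol_zero] at this

lemma tendsto_riccatiInv : Tendsto riccatiInv (𝓝[<] 1) atTop := by
  rw [tendsto_atTop]
  intro b
  have hb : riccatiSol (max b 0) < 1 := riccatiSol_lt_one (le_max_right _ _)
  filter_upwards [Ioo_mem_nhdsLT hb] with δ hδ
  have hδ' : δ ∈ Ico (0 : ℝ) 1 := ⟨(riccatiSol_nonneg (le_max_right b 0)).trans hδ.1.le, hδ.2⟩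
  refine (le_max_left b 0).trans ?_
  rw [← strictMonoOn_riccatiSol.le_iff_le (mem_Ici.2 (le_max_right b 0))
    (riccatiInv_mem hδ'), riccatiSol_riccatiInv hδ']
  exact hδ.1.le

/-- A monotone function whose image is an interval has no jump. The endpoint `0` is treated apart,
with neighborhoods on the right only. -/
lemma continuousOn_riccatiInv : ContinuousOn riccatiInv (Ico 0 1) := by
  have himg : riccatiInv '' Ico 0 1 = Ici 0 := by
    apply Subset.antisymm
    · rintro _ ⟨δ, hδ, rfl⟩
      exact riccatiInv_mem hδ
    · intro r hr
      exact ⟨riccatiSol r, ⟨riccatiSol_nonneg hr, riccatiSol_lt_one hr⟩, invOn_riccatiInv.1 hr⟩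
  intro δ hδ
  rcases eq_or_lt_of_le hδ.1 with rfl | hpos
  · refine (strictMonoOn_riccatiInv.continuousWithinAt_right_of_image_mem_nhdsWithin
      (Ico_mem_nhdsGE zero_lt_one) ?_).mono Ico_subset_Ici_self
    rw [himg, riccatiInv_zero]
    exact self_mem_nhdsWithin
  · refine (strictMonoOn_riccatiInv.continuousAt_of_image_mem_nhds
      (Ico_mem_nhds hpos hδ.2) ?_).continuousWithinAt
    rw [himg]
    refine Ici_mem_nhds ?_
    rw [← riccatiInv_zero]
    exact strictMonoOn_riccatiInv ⟨le_rfl, zero_lt_one⟩ hδ hpos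

/-! ### Area and length -/

/-- If `f` is continuous on `[0, R)`, `f 0 = 0` and `f' ≥ 0`, then `f` is nonnegative. -/
lemma nonneg_of_hasDerivAt_nonneg {f f' : ℝ → ℝ} {R : ℝ} (hc : ContinuousOn f (Ico 0 R))
    (h0 : 0 ≤ f 0) (hf : ∀ r ∈ Ioo 0 R, HasDerivAt f (f' r) r)
    (hf' : ∀ r ∈ Ioo 0 R, 0 ≤ f' r) {r : ℝ} (hr : r ∈ Ioo 0 R) : 0 ≤ f r := by
  have : MonotoneOn f (Ico 0 R) := by
    refine monotoneOn_of_deriv_nonneg (convex_Ico 0 R) hc ?_ ?_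
    · intro x hx
      rw [interior_Ico] at hx
      exact (hf x hx).differentiableAt.differentiableWithinAt
    · intro x hx
      rw [interior_Ico] at hx
      rw [(hf x hx).deriv]
      exact hf' x hx
  exact h0.trans (this ⟨le_rfl, hr.1.trans hr.2⟩ ⟨hr.1.le, hr.2⟩ hr.1.le)

/-- If the area `A` and the length `L` of the circles of a disk satisfy the inequalities which
hold when the curvature lies in `[-1, 0]`, then the isoperimetric ratio `A / L` exceeds
the solution of the Riccati equation, by a margin that does not shrink at the boundary. -/
lemma exists_lt_area_div_length {A L m : ℝ → ℝ} {R : ℝ} (hR : 0 < R)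
    (hAc : ContinuousOn A (Ico 0 R)) (hLc : ContinuousOn L (Ico 0 R))
    (hA0 : A 0 = 0) (hL0 : L 0 = 0)
    (hA : ∀ r ∈ Ioo 0 R, HasDerivAt A (L r) r) (hL : ∀ r ∈ Ioo 0 R, HasDerivAt L (m r) r)
    (hm : ∀ r ∈ Ioo 0 R, 2 * Real.pi ≤ m r) (hmA : ∀ r ∈ Ioo 0 R, m r ≤ 2 * Real.pi + A r) :
    ∃ r ∈ Ioo 0 R, riccatiSol R * L r < A r := by
  by_contra! hAL
  have hpi := Real.pi_pos
  -- Successive integrations from `0`: `L' ≥ 2π` gives `L ≥ 2πr`, then `A ≥ πr²`; and `(r L - A)' =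
  -- r L' ≥ 0` gives `A ≤ r L`.
  have hLr : ∀ r ∈ Ioo 0 R, 2 * Real.pi * r ≤ L r := fun r hr => by
    have := nonneg_of_hasDerivAt_nonneg (f := fun r => L r - 2 * Real.pi * r)
      (hLc.sub (by fun_prop)) (by simp [hL0])
      (fun r hr => (hL r hr).sub ((hasDerivAt_id r).const_mul _))
      (fun r hr => by simpa using hm r hr) hr
    linarith
  have hLpos : ∀ r ∈ Ioo 0 R, 0 < L r := fun r hr =>
    lt_of_lt_of_le (mul_pos (by positivity) hr.1) (hLr r hr)
  have hAr : ∀ r ∈ Ioo 0 R, Real.pi * r ^ 2 ≤ A r := fun r hr => by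
    have := nonneg_of_hasDerivAt_nonneg (f := fun r => A r - Real.pi * r ^ 2)
      (hAc.sub (by fun_prop)) (by simp [hA0])
      (fun r hr => (hA r hr).sub (((hasDerivAt_id r).pow 2).const_mul _))
      (fun r hr => by simpa using by linarith [hLr r hr]) hr
    linarith
  have hArL : ∀ r ∈ Ioo 0 R, A r ≤ r * L r := fun r hr => by
    have := nonneg_of_hasDerivAt_nonneg (f := fun r => r * L r - A r)
      ((continuousOn_id.mul hLc).sub hAc) (by simp [hA0])
      (fun r hr => ((hasDerivAt_id r).mul (hL r hr)).sub (hA r hr))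
      (fun r hr => by simpa using mul_nonneg hr.1.le (by linarith [hm r hr])) hr
    linarith
  have hApos : ∀ r ∈ Ioo 0 R, 0 < A r := fun r hr =>
    lt_of_lt_of_le (by have := hr.1; positivity) (hAr r hr)
  set Y : ℝ → ℝ := fun r => A r / L r with hY
  have hYpos : ∀ r ∈ Ioo 0 R, 0 < Y r := fun r hr => div_pos (hApos r hr) (hLpos r hr)
  have hYd : ∀ r ∈ Ioo 0 R, HasDerivAt Y (1 - A r * m r / L r ^ 2) r := fun r hr => by
    refine ((hA r hr).div (hL r hr) (hLpos r hr).ne').congr_deriv ?_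
    have := (hLpos r hr).ne'
    field_simp
  have hYd' : ∀ r ∈ Ioo 0 R, 1 - (1 + 2 / r ^ 2) * Y r ^ 2 ≤ 1 - A r * m r / L r ^ 2 := by
    intro r hr
    have hr0 := hr.1
    -- The term `2 / r²` of the Riccati equation is born here: `A ≥ πr²` absorbs the constant `2π`
    -- into `2 A / r²`.
    have h1 : m r ≤ (1 + 2 / r ^ 2) * A r := by
      have : 2 * Real.pi ≤ 2 / r ^ 2 * A r := by
        have := hAr r hr
        rw [div_mul_eq_mul_div, le_div_iff₀ (by positivity)]
        linarith
      linarith [hmA r hr]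
    have h2 : A r * m r / L r ^ 2 ≤ A r * ((1 + 2 / r ^ 2) * A r) / L r ^ 2 := by
      have := (hApos r hr).le
      gcongr
    have h3 : A r * ((1 + 2 / r ^ 2) * A r) / L r ^ 2 = (1 + 2 / r ^ 2) * Y r ^ 2 := by
      simp only [hY, div_pow]
      ring
    linarith
  have hY0 : Tendsto Y (𝓝[>] 0) (𝓝 0) := by
    refine tendsto_of_tendsto_of_tendsto_of_le_of_le' tendsto_const_nhds
      (tendsto_id.mono_left nhdsWithin_le_nhds : Tendsto id (𝓝[>] (0 : ℝ)) (𝓝 0)) ?_ ?_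
    all_goals filter_upwards [Ioo_mem_nhdsGT hR] with r hr
    · exact (hYpos r hr).le
    · exact (div_le_iff₀ (hLpos r hr)).2 (hArL r hr)
  have hle : ∀ r ∈ Ioo 0 R, riccatiSol r ≤ Y r :=
    riccati_le (fun r hr => hasDerivAt_riccatiSol hr.1) hYd hYd'
      (fun r hr => (hYpos r hr).le) isRiccatiSolution_riccatiSol.tendsto_zero hY0
  -- The inequality is strict somewhere.
  obtain ⟨r₀, hr₀, hlt⟩ : ∃ r ∈ Ioo 0 R, riccatiSol r < Y r := by
    by_contra! hge
    have heq : ∀ r ∈ Ioo 0 R, Y r = riccatiSol r := fun r hr =>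
      le_antisymm (hge r hr) (hle r hr)
    -- Equality throughout forces this value of `m`; with `m ≤ 2π + A` it gives the flat values `A =
    -- πr²`, `L = 2πr`, `m = 2π`. But then the formula reads `m = πr² + 2π`.
    have hmeq : ∀ r ∈ Ioo 0 R, m r = (1 + 2 / r ^ 2) * A r := fun r hr => by
      have h1 : HasDerivAt Y (1 - (1 + 2 / r ^ 2) * riccatiSol r ^ 2) r :=
        (hasDerivAt_riccatiSol hr.1).congr_of_eventuallyEq
          (eventually_of_mem (Ioo_mem_nhds hr.1 hr.2) heq)
      have h2 := (hYd r hr).unique h1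
      rw [← heq r hr] at h2
      simp only [hY] at h2
      have := (hLpos r hr).ne'
      have hAne := (hApos r hr).ne'
      have := hr.1.ne'
      field_simp at h2 ⊢
      exact mul_left_cancel₀ hAne (by linarith)
    have hAeq : ∀ r ∈ Ioo 0 R, A r = Real.pi * r ^ 2 := fun r hr => by
      refine le_antisymm ?_ (hAr r hr)
      have h1 : 2 / r ^ 2 * A r ≤ 2 * Real.pi := by linarith [hmeq r hr, hmA r hr]
      rw [div_mul_eq_mul_div, div_le_iff₀ (pow_pos hr.1 2)] at h1
      linarith
    have hLeq : ∀ r ∈ Ioo 0 R, L r = 2 * Real.pi * r := fun r hr => by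
      have h1 : HasDerivAt A (Real.pi * (2 * r)) r :=
        (((hasDerivAt_pow 2 r).const_mul Real.pi).congr_deriv (by norm_num)).congr_of_eventuallyEq
          (eventually_of_mem (Ioo_mem_nhds hr.1 hr.2) hAeq)
      rw [(hA r hr).unique h1]
      ring
    have hr : R / 2 ∈ Ioo 0 R := ⟨by linarith, by linarith⟩
    have h1 : HasDerivAt L (2 * Real.pi * 1) (R / 2) :=
      ((hasDerivAt_id _).const_mul _).congr_of_eventuallyEq
        (eventually_of_mem (Ioo_mem_nhds hr.1 hr.2) hLeq)
    have h2 := (hL _ hr).unique h1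
    have h3 := hmeq _ hr
    rw [h2, hAeq _ hr] at h3
    have := hr.1.ne'
    have h4 : 0 < Real.pi * (R / 2) ^ 2 := by have := hr.1; positivity
    have h5 : 2 / (R / 2) ^ 2 * (Real.pi * (R / 2) ^ 2) = 2 * Real.pi := by
      field_simp
    linarith
  -- The margin decreases at most exponentially.
  have hYlt : ∀ r ∈ Ioo 0 R, Y r ≤ riccatiSol R := fun r hr =>
    (div_le_iff₀ (hLpos r hr)).2 (hAL r hr)
  have hy1 : riccatiSol R < 1 := riccatiSol_lt_one hR.le
  -- `(Y - y)' ≥ -(1 + 2 / r²) (Y + y) (Y - y)`, and for `r ≥ r₀` the coefficient is at most `C`,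
  -- since `Y ≤ y R < 1` and `y < 1`.
  set C : ℝ := (1 + 2 / r₀ ^ 2) * 2 with hC
  have hsub : ∀ r ∈ Ico r₀ R, r ∈ Ioo 0 R := fun r hr => ⟨hr₀.1.trans_le hr.1, hr.2⟩
  have hwd : ∀ r ∈ Ioo 0 R, HasDerivAt (fun r => (Y r - riccatiSol r) * Real.exp (C * r))
      ((1 - A r * m r / L r ^ 2 - (1 - (1 + 2 / r ^ 2) * riccatiSol r ^ 2)) * Real.exp (C * r)
        + (Y r - riccatiSol r) * (Real.exp (C * r) * (C * 1))) r := fun r hr =>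
    ((hYd r hr).sub (hasDerivAt_riccatiSol hr.1)).mul ((hasDerivAt_id r).const_mul C).exp
  have hmono : MonotoneOn (fun r => (Y r - riccatiSol r) * Real.exp (C * r)) (Ico r₀ R) := by
    refine monotoneOn_of_deriv_nonneg (convex_Ico r₀ R)
      (fun r hr => (hwd r (hsub r hr)).continuousAt.continuousWithinAt) ?_ ?_
    · intro r hr
      rw [interior_Ico] at hr
      exact (hwd r (hsub r (Ioo_subset_Ico_self hr))).differentiableAt.differentiableWithinAt
    · intro r hr
      rw [interior_Ico] at hr
      have hr' := hsub r (Ioo_subset_Ico_self hr)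
      rw [(hwd r hr').deriv]
      have h1 := hYd' r hr'
      have h2 := hle r hr'
      have h3 : (1 + 2 / r ^ 2) * (Y r + riccatiSol r) ≤ C := by
        have h4 : 2 / r ^ 2 ≤ 2 / r₀ ^ 2 := by
          have := hr₀.1
          gcongr
          exact hr.1.le
        have h5 : Y r + riccatiSol r ≤ 2 := by linarith [hYlt r hr', riccatiSol_lt_one hr'.1.le]
        have h6 := (hYpos r hr').le
        have h7 := riccatiSol_nonneg hr'.1.le
        rw [hC]
        have := hr₀.1
        gcongr
      have h8 : (1 + 2 / r ^ 2) * (Y r + riccatiSol r) * (Y r - riccatiSol r)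
          ≤ C * (Y r - riccatiSol r) := by
        have : 0 ≤ Y r - riccatiSol r := by linarith
        gcongr
      have h9 : 0 ≤ (1 - A r * m r / L r ^ 2 - (1 - (1 + 2 / r ^ 2) * riccatiSol r ^ 2))
          + C * (Y r - riccatiSol r) := by nlinarith
      have := mul_nonneg h9 (Real.exp_pos (C * r)).le
      linarith
  set ε : ℝ := (Y r₀ - riccatiSol r₀) * Real.exp (C * r₀) / Real.exp (C * R) with hε
  have hεpos : 0 < ε := by
    have : 0 < Y r₀ - riccatiSol r₀ := by linarith
    positivity
  have hgap : ∀ r ∈ Ico r₀ R, riccatiSol r ≤ riccatiSol R - ε := fun r hr => by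
    have h1 := hmono ⟨le_rfl, hr₀.2⟩ hr hr.1
    have hr' := hsub r hr
    have h2 : ε ≤ Y r - riccatiSol r := by
      rw [hε, div_le_iff₀ (Real.exp_pos _)]
      refine h1.trans ?_
      have : 0 ≤ Y r - riccatiSol r := by linarith [hle r hr']
      have hC0 : 0 ≤ C := by positivity
      have := hr.2.le
      simp only
      gcongr
    linarith [hYlt r hr']
  have hlim : Tendsto riccatiSol (𝓝[<] R) (𝓝 (riccatiSol R)) :=
    (hasDerivAt_riccatiSol hR).continuousAt.tendsto.mono_left nhdsWithin_le_nhds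
  have := le_of_tendsto hlim
    (eventually_of_mem (Ico_mem_nhdsLT hr₀.2) hgap)
  linarith

/-! ### Autonomous ordinary differential equations -/

section ODE

variable {E : Type*} [NormedAddCommGroup E] [NormedSpace ℝ E]

/-- `z` is on `[0, T]` a solution of `z' = F z` with values in `Ω`. -/
def IsSol (F : E → E) (Ω : Set E) (z : ℝ → E) (T : ℝ) : Prop :=
  ∀ t ∈ Icc 0 T, z t ∈ Ω ∧ HasDerivWithinAt z (F (z t)) (Icc 0 T) t

variable {F : E → E} {Ω C : Set E} {z w : ℝ → E} {T ρ R : ℝ}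

lemma IsSol.mem (h : IsSol F Ω z T) {t : ℝ} (ht : t ∈ Icc 0 T) : z t ∈ Ω := (h t ht).1

lemma IsSol.continuousOn (h : IsSol F Ω z T) : ContinuousOn z (Icc 0 T) :=
  fun t ht => (h t ht).2.continuousWithinAt

lemma IsSol.mono (h : IsSol F Ω z T) (hρ : ρ ≤ T) : IsSol F Ω z ρ := fun t ht =>
  ⟨(h t ⟨ht.1, ht.2.trans hρ⟩).1,
    (h t ⟨ht.1, ht.2.trans hρ⟩).2.mono (Icc_subset_Icc_right hρ)⟩

lemma IsSol.congr (h : IsSol F Ω z T) (hw : EqOn w z (Icc 0 T)) : IsSol F Ω w T := fun t ht => by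
  rw [hw ht]
  exact ⟨(h t ht).1, (h t ht).2.congr hw (hw ht)⟩

lemma hasDerivWithinAt_Ici_of_Icc {f : ℝ → E} {f' : E} {t : ℝ}
    (h : HasDerivWithinAt f f' (Icc 0 T) t) (ht : t ∈ Ico 0 T) :
    HasDerivWithinAt f f' (Ici t) t :=
  h.mono_of_mem_nhdsWithin (mem_of_superset (Icc_mem_nhdsGE ht.2) (Icc_subset_Icc_left ht.1))

lemma IsSol.hasDerivWithinAt_Ici (h : IsSol F Ω z T) {t : ℝ} (ht : t ∈ Ico 0 T) :
    HasDerivWithinAt z (F (z t)) (Ici t) t :=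
  hasDerivWithinAt_Ici_of_Icc (h t (Ico_subset_Icc_self ht)).2 ht

/-- With a global bound `B`, the ball of radius `B * T` cannot be left before the time `T`, so a
single application of Picard–Lindelöf covers `[0, T]`. -/
lemma exists_solution_of_bounded_lipschitz [CompleteSpace E] {G : E → E} {K : NNReal} {B : ℝ}
    (hK : LipschitzWith K G) (hB : ∀ x, ‖G x‖ ≤ B) (hT : 0 ≤ T) (x : E) :
    ∃ z : ℝ → E, z 0 = x ∧ ∀ t ∈ Icc 0 T, HasDerivWithinAt z (G (z t)) (Icc 0 T) t := by
  have hB0 : 0 ≤ B := (norm_nonneg _).trans (hB x)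
  lift B to NNReal using hB0
  lift T to NNReal using hT
  have : IsPicardLindelof (fun _ => G) (tmin := 0) (tmax := T) ⟨0, le_rfl, T.2⟩ x (B * T) 0 B K :=
    { lipschitzOnWith := fun _ _ => hK.lipschitzOnWith
      continuousOn := fun _ _ => continuousOn_const
      norm_le := fun _ _ y _ => hB y
      mul_max_le := by simp }
  exact this.exists_eq_forall_mem_Icc_hasDerivWithinAt₀

lemma gronwallBound_mul (c δ K ε x : ℝ) :
    gronwallBound (c * δ) K (c * ε) x = c * gronwallBound δ K ε x := by
  unfold gronwallBound
  split_ifs <;> ring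

/-- A `C¹` vector field with compact support is uniformly differentiable. -/
lemma exists_norm_sub_sub_fderiv_le {G : E → E} (hG : ContDiff ℝ 1 G) (hGc : HasCompactSupport G)
    {ε : ℝ} (hε : 0 < ε) : ∃ η > 0, ∀ a b, dist b a < η →
      ‖G b - G a - fderiv ℝ G a (b - a)‖ ≤ ε * ‖b - a‖ := by
  have huc : UniformContinuous (fderiv ℝ G) :=
    (hG.continuous_fderiv one_ne_zero).uniformContinuous_of_tendsto_cocompact
      ((hGc.fderiv ℝ).is_zero_at_infty)
  obtain ⟨η, hη, h⟩ := Metric.uniformContinuous_iff.1 huc ε hε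
  refine ⟨η, hη, fun a b hab => ?_⟩
  refine (convex_ball a η).norm_image_sub_le_of_norm_fderiv_le' (f := G) (𝕜 := ℝ)
    (fun x _ => hG.differentiable one_ne_zero x) (fun x hx => ?_)
    (Metric.mem_ball_self hη) hab
  rw [← dist_eq_norm]
  exact (h (Metric.mem_ball.1 hx)).le

variable [FiniteDimensional ℝ E]

/-- A `C¹` vector field on an open set may be modified away from a compact set to become
a compactly supported one. -/
lemma exists_contDiff_compactSupport_eqOn (hΩ : IsOpen Ω) (hF : ContDiffOn ℝ 1 F Ω)
    (hC : IsCompact C) (hCΩ : C ⊆ Ω) :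
    ∃ (G : E → E) (U : Set E), ContDiff ℝ 1 G ∧ HasCompactSupport G ∧ IsOpen U ∧ C ⊆ U ∧
      closure U ⊆ Ω ∧ EqOn G F (closure U) := by
  -- The cutoff is `1` on `L'` and vanishes off `L`, with `C ⊆ interior L' ⊆ L' ⊆ interior L`.
  obtain ⟨L, hL, hCL, hLΩ⟩ := exists_compact_between hC hΩ hCΩ
  obtain ⟨L', hL', hCL', hL'L⟩ := exists_compact_between hC isOpen_interior hCL
  obtain ⟨χ, hχ1, hχ0, -⟩ := exists_contMDiffMap_one_nhds_of_subset_interior (n := (⊤ : ℕ∞))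
    (modelWithCornersSelf ℝ E) hL'.isClosed hL'L
  have hχ : ContDiff ℝ 1 χ := (χ.contMDiff.contDiff).of_le (by simp)
  refine ⟨fun x => χ x • F x, interior L', ?_, ?_, isOpen_interior, hCL', ?_, ?_⟩
  · rw [contDiff_iff_contDiffAt]
    intro x
    by_cases hx : x ∈ Ω
    · exact hχ.contDiffAt.smul (hF.contDiffAt (hΩ.mem_nhds hx))
    · have hxL : x ∈ Lᶜ := fun h => hx (hLΩ h)
      have : (fun x => χ x • F x) =ᶠ[𝓝 x] fun _ => 0 := by
        filter_upwards [hL.isClosed.isOpen_compl.mem_nhds hxL] with y hy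
        rw [hχ0 y hy, zero_smul]
      exact contDiffAt_const.congr_of_eventuallyEq this
  · exact HasCompactSupport.intro hL fun x hx => by rw [hχ0 x hx, zero_smul]
  · exact (closure_minimal interior_subset hL'.isClosed).trans
      (hL'L.trans (interior_subset.trans hLΩ))
  · intro x hx
    have : x ∈ L' := closure_minimal interior_subset hL'.isClosed hx
    simp only
    rw [hχ1.self_of_nhdsSet x this, one_smul]

/-- Two solutions that stay in a compact set diverge at most linearly in their initial values. -/
lemma exists_dist_le_of_isSol (hΩ : IsOpen Ω) (hF : ContDiffOn ℝ 1 F Ω)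
    (hC : IsCompact C) (hCΩ : C ⊆ Ω) (ρ : ℝ) :
    ∃ M : ℝ, ∀ z w : ℝ → E, IsSol F Ω z ρ → IsSol F Ω w ρ → (∀ t ∈ Icc 0 ρ, z t ∈ C) →
      (∀ t ∈ Icc 0 ρ, w t ∈ C) → ∀ t ∈ Icc 0 ρ, dist (z t) (w t) ≤ M * dist (z 0) (w 0) := by
  obtain ⟨G, U, hG, hGc, hU, hCU, hUΩ, hGF⟩ := exists_contDiff_compactSupport_eqOn hΩ hF hC hCΩ
  obtain ⟨K, hK⟩ := hG.lipschitzWith_of_hasCompactSupport hGc one_ne_zero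
  refine ⟨Real.exp (K * ρ), fun z w hz hw hzC hwC t ht => ?_⟩
  have key : ∀ z, IsSol F Ω z ρ → (∀ t ∈ Icc 0 ρ, z t ∈ C) → ∀ t ∈ Ico 0 ρ,
      HasDerivWithinAt z (G (z t)) (Ici t) t := fun z hz hzC t ht => by
    rw [hGF (subset_closure (hCU (hzC t (Ico_subset_Icc_self ht))))]
    exact hz.hasDerivWithinAt_Ici ht
  have := dist_le_of_trajectories_ODE (v := fun _ => G) (fun _ => hK) hz.continuousOn
    (key z hz hzC) hw.continuousOn (key w hw hwC) le_rfl t ht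
  rw [mul_comm]
  refine this.trans ?_
  rw [sub_zero]
  have := ht.2
  gcongr

lemma IsSol.eqOn (hΩ : IsOpen Ω) (hF : ContDiffOn ℝ 1 F Ω) (hz : IsSol F Ω z T)
    (hw : IsSol F Ω w T) (h0 : z 0 = w 0) : EqOn z w (Icc 0 T) := by
  intro t ht
  have hC : IsCompact (z '' Icc 0 T ∪ w '' Icc 0 T) :=
    (isCompact_Icc.image_of_continuousOn hz.continuousOn).union
      (isCompact_Icc.image_of_continuousOn hw.continuousOn)
  obtain ⟨M, hM⟩ := exists_dist_le_of_isSol hΩ hF hC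
    (union_subset (image_subset_iff.2 fun t ht => hz.mem ht)
      (image_subset_iff.2 fun t ht => hw.mem ht)) T
  have := hM z w hz hw (fun t ht => Or.inl (mem_image_of_mem z ht))
    (fun t ht => Or.inr (mem_image_of_mem w ht)) t ht
  rw [h0, dist_self, mul_zero] at this
  exact dist_le_zero.1 this

/-- A solution exists as long as it is known in advance to remain in a compact set. -/
lemma exists_isSol_of_apriori (hΩ : IsOpen Ω) (hF : ContDiffOn ℝ 1 F Ω)
    (hC : IsCompact C) (hCΩ : C ⊆ Ω) {x : E} (hx : x ∈ C) (hρ : 0 ≤ ρ)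
    (h : ∀ T ∈ Icc 0 ρ, ∀ z, IsSol F Ω z T → z 0 = x → z T ∈ C) :
    ∃ z, z 0 = x ∧ IsSol F Ω z ρ := by
  obtain ⟨G, U, hG, hGc, hU, hCU, hUΩ, hGF⟩ := exists_contDiff_compactSupport_eqOn hΩ hF hC hCΩ
  obtain ⟨K, hK⟩ := hG.lipschitzWith_of_hasCompactSupport hGc one_ne_zero
  obtain ⟨B, hB⟩ := hGc.exists_bound_of_continuous hG.continuous
  obtain ⟨z, hz0, hz⟩ := exists_solution_of_bounded_lipschitz hK hB hρ x
  have hzc : ContinuousOn z (Icc 0 ρ) := fun t ht => (hz t ht).continuousWithinAt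
  have hsol : ∀ T ∈ Icc 0 ρ, (∀ t ∈ Icc 0 T, z t ∈ closure U) → IsSol F Ω z T :=
    fun T hT hzU t ht => ⟨hUΩ (hzU t ht), by
      rw [← hGF (hzU t ht)]
      exact (hz t ⟨ht.1, ht.2.trans hT.2⟩).mono (Icc_subset_Icc_right hT.2)⟩
  -- Up to a first exit time `s` from `U`, the curve lies in `closure U`, where `G = F`. It is thus
  -- a solution for `F` on `[0, s]`, and the a priori hypothesis puts `z s` in `C ⊆ U`.
  have hall : ∀ t ∈ Icc 0 ρ, z t ∈ U := by
    by_contra! hne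
    obtain ⟨t₁, ht₁, ht₁U⟩ := hne
    have hcomp : IsCompact (Icc 0 ρ ∩ z ⁻¹' Uᶜ) :=
      isCompact_Icc.of_isClosed_subset
        (hzc.preimage_isClosed_of_isClosed isClosed_Icc hU.isClosed_compl) inter_subset_left
    obtain ⟨s, ⟨hs, hsU⟩, hmin⟩ := hcomp.exists_isLeast ⟨t₁, ht₁, ht₁U⟩
    have hlt : ∀ t ∈ Ico 0 s, z t ∈ U := fun t ht => by
      by_contra hc
      exact absurd (hmin ⟨⟨ht.1, ht.2.le.trans hs.2⟩, hc⟩) (not_le.2 ht.2)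
    have hs0 : 0 < s := by
      refine lt_of_le_of_ne hs.1 fun h0 => hsU ?_
      rw [← h0, hz0]
      exact hCU hx
    have hscl : z s ∈ closure U := by
      have h1 : Tendsto z (𝓝[Ico 0 s] s) (𝓝 (z s)) :=
        (hzc s hs).mono_left (nhdsWithin_mono _ fun t ht => ⟨ht.1, ht.2.le.trans hs.2⟩)
      have : (𝓝[Ico 0 s] s).NeBot := by
        rw [← mem_closure_iff_nhdsWithin_neBot, closure_Ico hs0.ne]
        exact ⟨hs0.le, le_rfl⟩
      exact mem_closure_of_tendsto h1 (eventually_of_mem self_mem_nhdsWithin hlt)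
    refine hsU (hCU (h s hs z (hsol s hs fun t ht => ?_) hz0))
    rcases eq_or_lt_of_le ht.2 with rfl | hts
    · exact hscl
    · exact subset_closure (hlt t ⟨ht.1, hts⟩)
  exact ⟨z, hz0, hsol ρ ⟨hρ, le_rfl⟩ fun t ht => subset_closure (hall t ht)⟩

/-- By uniqueness the solutions on the various `[0, ρ]` agree, so the diagonal `t ↦ w t t` is a
solution on each of them. -/
lemma exists_isSol_glue (hΩ : IsOpen Ω) (hF : ContDiffOn ℝ 1 F Ω) {x : E} (hR : 0 < R)
    (h : ∀ ρ ∈ Ico 0 R, ∃ z, z 0 = x ∧ IsSol F Ω z ρ) :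
    ∃ z, z 0 = x ∧ ∀ ρ ∈ Ico 0 R, IsSol F Ω z ρ := by
  choose! w hw0 hw using h
  refine ⟨fun t => w t t, hw0 0 ⟨le_rfl, hR⟩, fun ρ hρ => (hw ρ hρ).congr fun t ht => ?_⟩
  have ht' : t ∈ Ico 0 R := ⟨ht.1, ht.2.trans_lt hρ.2⟩
  exact (hw t ht').eqOn hΩ hF ((hw ρ hρ).mono ht.2) ((hw0 t ht').trans (hw0 ρ hρ).symm)
    ⟨ht.1, le_rfl⟩

/-- Joint continuity of a family of solutions. -/
lemma continuousOn_uncurry_isSol (hΩ : IsOpen Ω) (hF : ContDiffOn ℝ 1 F Ω)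
    (hC : IsCompact C) (hCΩ : C ⊆ Ω) {Z : ℝ → ℝ → E} (hZ : ∀ θ, IsSol F Ω (Z θ) ρ)
    (hZC : ∀ θ, ∀ t ∈ Icc 0 ρ, Z θ t ∈ C) (h0 : Continuous fun θ => Z θ 0) :
    ContinuousOn (fun p : ℝ × ℝ => Z p.1 p.2) (univ ×ˢ Icc 0 ρ) := by
  obtain ⟨M, hM⟩ := exists_dist_le_of_isSol hΩ hF hC hCΩ ρ
  rintro ⟨θ₀, t₀⟩ ⟨-, ht₀ : t₀ ∈ Icc 0 ρ⟩
  rw [ContinuousWithinAt, tendsto_iff_dist_tendsto_zero]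
  have hlim : Tendsto (fun p : ℝ × ℝ => M * dist (Z p.1 0) (Z θ₀ 0) + dist (Z θ₀ p.2) (Z θ₀ t₀))
      (𝓝[univ ×ˢ Icc 0 ρ] (θ₀, t₀)) (𝓝 0) := by
    have h1 : Tendsto (fun p : ℝ × ℝ => dist (Z p.1 0) (Z θ₀ 0)) (𝓝 (θ₀, t₀)) (𝓝 0) :=
      tendsto_iff_dist_tendsto_zero.1 ((h0.comp continuous_fst).tendsto (θ₀, t₀))
    have h2 : Tendsto (fun p : ℝ × ℝ => Z θ₀ p.2) (𝓝[univ ×ˢ Icc 0 ρ] (θ₀, t₀))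
        (𝓝 (Z θ₀ t₀)) := by
      refine ((hZ θ₀).continuousOn t₀ ht₀).tendsto.comp ?_
      exact tendsto_nhdsWithin_iff.2 ⟨(continuous_snd.tendsto _).mono_left nhdsWithin_le_nhds,
        eventually_of_mem self_mem_nhdsWithin fun p hp => hp.2⟩
    simpa using ((h1.mono_left nhdsWithin_le_nhds).const_mul M).add
      (tendsto_iff_dist_tendsto_zero.1 h2)
  refine squeeze_zero' (Eventually.of_forall fun _ => dist_nonneg) ?_ hlim
  filter_upwards [self_mem_nhdsWithin] with p hp
  exact (dist_triangle _ (Z θ₀ p.2) _).trans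
    (add_le_add_left (hM _ _ (hZ p.1) (hZ θ₀) (hZC p.1) (hZC θ₀) p.2 hp.2) _)

/-- Differentiability of solutions with respect to a parameter of the initial value: the
derivative is the solution of the linearized equation. -/
lemma hasDerivAt_isSol_param (hΩ : IsOpen Ω) (hF : ContDiffOn ℝ 1 F Ω)
    (hC : IsCompact C) (hCΩ : C ⊆ Ω) {Z : ℝ → ℝ → E} (hZ : ∀ θ, IsSol F Ω (Z θ) ρ)
    (hZC : ∀ θ, ∀ t ∈ Icc 0 ρ, Z θ t ∈ C) {θ₀ : ℝ} {ζ : ℝ → E}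
    (hζ0 : HasDerivAt (fun θ => Z θ 0) (ζ 0) θ₀)
    (hζ : ∀ t ∈ Icc 0 ρ, HasDerivWithinAt ζ (fderiv ℝ F (Z θ₀ t) (ζ t)) (Icc 0 ρ) t)
    {t : ℝ} (ht : t ∈ Icc 0 ρ) : HasDerivAt (fun θ => Z θ t) (ζ t) θ₀ := by
  obtain ⟨M, hM⟩ := exists_dist_le_of_isSol hΩ hF hC hCΩ ρ
  obtain ⟨G, U, hG, hGc, hU, hCU, hUΩ, hGF⟩ := exists_contDiff_compactSupport_eqOn hΩ hF hC hCΩ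
  obtain ⟨K, hK⟩ := (hGc.fderiv ℝ).exists_bound_of_continuous (hG.continuous_fderiv one_ne_zero)
  have hfd : ∀ x ∈ C, fderiv ℝ F x = fderiv ℝ G x := fun x hx =>
    Filter.EventuallyEq.fderiv_eq (eventually_of_mem (hU.mem_nhds (hCU hx))
      fun y hy => (hGF (subset_closure hy)).symm)
  obtain ⟨D, hD0, hD⟩ : ∃ D, 0 < D ∧ ∀ᶠ θ in 𝓝 θ₀, dist (Z θ 0) (Z θ₀ 0) ≤ D * ‖θ - θ₀‖ := by
    obtain ⟨D, hD0, hD⟩ := hζ0.isBigO_sub.exists_pos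
    exact ⟨D, hD0, by simpa [dist_eq_norm] using hD.bound⟩
  rw [hasDerivAt_iff_isLittleO] at hζ0 ⊢
  rw [Asymptotics.isLittleO_iff]
  intro c hc
  set B := gronwallBound 1 K (|M| * D) t with hB
  obtain ⟨ε, hε, hεB⟩ : ∃ ε > 0, ε * B ≤ c := by
    refine ⟨c / (|B| + 1), by positivity, ?_⟩
    rw [div_mul_eq_mul_div, div_le_iff₀ (by positivity)]
    nlinarith [le_abs_self B]
  obtain ⟨η, hη, hGη⟩ := exists_norm_sub_sub_fderiv_le hG hGc hε
  have hsmall : ∀ᶠ θ in 𝓝 θ₀, |M| * (D * ‖θ - θ₀‖) < η := by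
    have : Tendsto (fun θ : ℝ => |M| * (D * ‖θ - θ₀‖)) (𝓝 θ₀) (𝓝 (|M| * (D * ‖θ₀ - θ₀‖))) :=
      (by fun_prop : Continuous fun θ : ℝ => |M| * (D * ‖θ - θ₀‖)).tendsto θ₀
    rw [sub_self, norm_zero, mul_zero, mul_zero] at this
    exact this.eventually (gt_mem_nhds hη)
  filter_upwards [hD, hsmall, Asymptotics.isLittleO_iff.1 hζ0 hε] with θ hθD hθη hθ0
  have hdist : ∀ s ∈ Icc 0 ρ, dist (Z θ s) (Z θ₀ s) ≤ |M| * (D * ‖θ - θ₀‖) := fun s hs =>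
    (hM _ _ (hZ θ) (hZ θ₀) (hZC θ) (hZC θ₀) s hs).trans
      (mul_le_mul (le_abs_self M) hθD dist_nonneg (abs_nonneg M))
  -- Grönwall for the first order remainder: its initial value and the inhomogeneous term of its
  -- equation are both small multiples of `ε * ‖θ - θ₀‖`, which factors out of the bound by
  -- `gronwallBound_mul`.
  have hGw := norm_le_gronwallBound_of_norm_deriv_right_le
    (f := fun s => Z θ s - Z θ₀ s - (θ - θ₀) • ζ s)
    (f' := fun s => F (Z θ s) - F (Z θ₀ s) - (θ - θ₀) • fderiv ℝ F (Z θ₀ s) (ζ s))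
    (δ := (ε * ‖θ - θ₀‖) * 1) (K := K) (ε := (ε * ‖θ - θ₀‖) * (|M| * D)) (a := 0) (b := ρ)
    (((hZ θ).continuousOn.sub (hZ θ₀).continuousOn).sub
      (ContinuousOn.const_smul (fun s hs => (hζ s hs).continuousWithinAt) _))
    (fun s hs => (((hZ θ).hasDerivWithinAt_Ici hs).sub ((hZ θ₀).hasDerivWithinAt_Ici hs)).sub
      ((hasDerivWithinAt_Ici_of_Icc (hζ s (Ico_subset_Icc_self hs)) hs).const_smul _))
    (by simpa using hθ0) (fun s hs => ?_) t ht
  · rw [gronwallBound_mul, sub_zero, ← hB] at hGw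
    refine hGw.trans ?_
    calc ε * ‖θ - θ₀‖ * B = ε * B * ‖θ - θ₀‖ := by ring
      _ ≤ c * ‖θ - θ₀‖ := by gcongr
  · have hs' := Ico_subset_Icc_self hs
    rw [hfd _ (hZC θ₀ s hs'), ← hGF (subset_closure (hCU (hZC θ s hs'))),
      ← hGF (subset_closure (hCU (hZC θ₀ s hs')))]
    have h1 := hGη (Z θ₀ s) (Z θ s) ((hdist s hs').trans_lt hθη)
    have h2 : G (Z θ s) - G (Z θ₀ s) - (θ - θ₀) • fderiv ℝ G (Z θ₀ s) (ζ s) =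
        (G (Z θ s) - G (Z θ₀ s) - fderiv ℝ G (Z θ₀ s) (Z θ s - Z θ₀ s)) +
          fderiv ℝ G (Z θ₀ s) (Z θ s - Z θ₀ s - (θ - θ₀) • ζ s) := by
      simp only [map_sub, map_smul]
      abel
    rw [h2]
    refine (norm_add_le _ _).trans ?_
    have h3 := (fderiv ℝ G (Z θ₀ s)).le_of_opNorm_le (hK (Z θ₀ s))
      (Z θ s - Z θ₀ s - (θ - θ₀) • ζ s)
    have h4 : ε * ‖Z θ s - Z θ₀ s‖ ≤ ε * ‖θ - θ₀‖ * (|M| * D) := by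
      rw [← dist_eq_norm]
      calc ε * dist (Z θ s) (Z θ₀ s) ≤ ε * (|M| * (D * ‖θ - θ₀‖)) := by
            gcongr
            exact hdist s hs'
        _ = _ := by ring
    linarith

end ODE

/-! ### Calculus in the plane -/

lemma isOpen_disk : IsOpen disk := Metric.isOpen_ball

lemma fderiv_apply_eq_pd (f : Plane → ℝ) (x w : Plane) :
    fderiv ℝ f x w = pd 0 f x * w 0 + pd 1 f x * w 1 := by
  have hw : w = w 0 • EuclideanSpace.single 0 1 + w 1 • EuclideanSpace.single 1 1 := by
    ext i
    fin_cases i <;> simp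
  conv_lhs => rw [hw]
  simp only [map_add, map_smul, smul_eq_mul, pd]
  ring

/-- The chain rule along a curve. -/
lemma hasDerivWithinAt_comp_curve {f : Plane → ℝ} {x : ℝ → Plane} {Y : Plane} {s : Set ℝ} {t : ℝ}
    (hf : DifferentiableAt ℝ f (x t)) (hx : HasDerivWithinAt x Y s t) :
    HasDerivWithinAt (fun t => f (x t)) (pd 0 f (x t) * Y 0 + pd 1 f (x t) * Y 1) s t := by
  rw [← fderiv_apply_eq_pd]
  exact hf.hasFDerivAt.comp_hasDerivWithinAt t hx

lemma hasDerivWithinAt_coord {x : ℝ → Plane} {Y : Plane} {s : Set ℝ} {t : ℝ}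
    (hx : HasDerivWithinAt x Y s t) (i : Fin 2) :
    HasDerivWithinAt (fun t => x t i) (Y i) s t :=
  (EuclideanSpace.proj (𝕜 := ℝ) i).hasFDerivAt.comp_hasDerivWithinAt t hx

lemma hasDerivWithinAt_of_coord {x : ℝ → Plane} {Y : Plane} {s : Set ℝ} {t : ℝ}
    (hx : ∀ i, HasDerivWithinAt (fun t => x t i) (Y i) s t) : HasDerivWithinAt x Y s t := by
  have := (PiLp.continuousLinearEquiv 2 ℝ (fun _ : Fin 2 => ℝ)).symm.hasFDerivAt
    |>.comp_hasDerivWithinAt t (hasDerivWithinAt_pi.2 hx)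
  exact this

lemma contDiffOn_pd {f : Plane → ℝ} (hf : ContDiffOn ℝ ∞ f disk) (i : Fin 2) :
    ContDiffOn ℝ ∞ (pd i f) disk :=
  (hf.fderiv_of_isOpen isOpen_disk (by simp)).clm_apply contDiffOn_const

lemma differentiableAt_of_contDiffOn {f : Plane → ℝ} (hf : ContDiffOn ℝ ∞ f disk) {x : Plane}
    (hx : x ∈ disk) : DifferentiableAt ℝ f x :=
  (hf.contDiffAt (isOpen_disk.mem_nhds hx)).differentiableAt (by simp)

lemma pd_congr {f g : Plane → ℝ} (h : EqOn f g disk) {x : Plane} (hx : x ∈ disk) (i : Fin 2) :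
    pd i f x = pd i g x := by
  unfold pd
  rw [Filter.EventuallyEq.fderiv_eq (eventually_of_mem (isOpen_disk.mem_nhds hx) h)]

lemma pd_comm {f : Plane → ℝ} (hf : ContDiffOn ℝ ∞ f disk) {x : Plane} (hx : x ∈ disk)
    (i j : Fin 2) : pd i (pd j f) x = pd j (pd i f) x := by
  have hx' := hf.contDiffAt (isOpen_disk.mem_nhds hx)
  have hd : DifferentiableAt ℝ (fderiv ℝ f) x :=
    (hx'.fderiv_right (m := 1) (by norm_cast)).differentiableAt (by simp)
  have h : ∀ i j : Fin 2, pd i (pd j f) x =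
      fderiv ℝ (fderiv ℝ f) x (EuclideanSpace.single i 1) (EuclideanSpace.single j 1) := by
    intro i j
    unfold pd
    rw [fderiv_clm_apply hd (differentiableAt_const _)]
    simp
  rw [h, h]
  exact (hx'.isSymmSndFDerivAt (by simp; norm_cast)).eq _ _

lemma pd_add {f g : Plane → ℝ} {x : Plane} (hf : DifferentiableAt ℝ f x)
    (hg : DifferentiableAt ℝ g x) (i : Fin 2) :
    pd i (fun y => f y + g y) x = pd i f x + pd i g x := by
  unfold pd
  rw [fderiv_fun_add hf hg]
  rfl

lemma pd_mul {f g : Plane → ℝ} {x : Plane} (hf : DifferentiableAt ℝ f x)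
    (hg : DifferentiableAt ℝ g x) (i : Fin 2) :
    pd i (fun y => f y * g y) x = pd i f x * g x + f x * pd i g x := by
  unfold pd
  rw [fderiv_fun_mul hf hg]
  simp
  ring

/-! ### The Levi-Civita connection -/

section Metric

variable {q : Plane → Matrix (Fin 2) (Fin 2) ℝ}

lemma inv_eq_smul_adjugate (x : Plane) : (q x)⁻¹ = (q x).det⁻¹ • (q x).adjugate := by
  rw [Matrix.inv_def, Ring.inverse_eq_inv']

namespace IsRiemannianMetric

lemma symm (hq : IsRiemannianMetric q) {x : Plane} (hx : x ∈ disk) (i j : Fin 2) :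
    q x i j = q x j i := by
  simpa using (hq.posDef x hx).isHermitian.apply j i

lemma det_pos (hq : IsRiemannianMetric q) {x : Plane} (hx : x ∈ disk) : 0 < (q x).det :=
  (hq.posDef x hx).det_pos

lemma det_eq (hq : IsRiemannianMetric q) {x : Plane} (hx : x ∈ disk) :
    (q x).det = q x 0 0 * q x 1 1 - q x 0 1 ^ 2 := by
  rw [Matrix.det_fin_two, hq.symm hx 1 0]
  ring

lemma diag_pos (hq : IsRiemannianMetric q) {x : Plane} (hx : x ∈ disk) (i : Fin 2) : 0 < q x i i :=
  (hq.posDef x hx).diag_pos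

lemma contDiffOn_det (hq : IsRiemannianMetric q) : ContDiffOn ℝ ∞ (fun x => (q x).det) disk := by
  simp only [Matrix.det_fin_two]
  exact ((hq.smooth 0 0).mul (hq.smooth 1 1)).sub ((hq.smooth 0 1).mul (hq.smooth 1 0))

lemma contDiffOn_inv (hq : IsRiemannianMetric q) (i j : Fin 2) :
    ContDiffOn ℝ ∞ (fun x => (q x)⁻¹ i j) disk := by
  have h : ContDiffOn ℝ ∞ (fun x => (q x).det⁻¹ * (q x).adjugate i j) disk := by
    refine (hq.contDiffOn_det.inv fun x hx => (hq.det_pos hx).ne').mul ?_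
    simp only [Matrix.adjugate_fin_two]
    fin_cases i <;> fin_cases j
    · simpa using hq.smooth 1 1
    · simpa using (hq.smooth 0 1).neg
    · simpa using (hq.smooth 1 0).neg
    · simpa using hq.smooth 0 0
  refine h.congr fun x hx => ?_
  rw [inv_eq_smul_adjugate]
  rfl

lemma contDiffOn_christoffel (hq : IsRiemannianMetric q) (k i j : Fin 2) :
    ContDiffOn ℝ ∞ (christoffel q k i j) disk := by
  unfold christoffel
  refine contDiffOn_const.mul (ContDiffOn.sum fun l _ => (hq.contDiffOn_inv k l).mul ?_)
  exact ((contDiffOn_pd (hq.smooth j l) i).add (contDiffOn_pd (hq.smooth i l) j)).sub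
    (contDiffOn_pd (hq.smooth i j) l)

lemma contDiffOn_riemannTensor (hq : IsRiemannianMetric q) (l i j k : Fin 2) :
    ContDiffOn ℝ ∞ (riemannTensor q l i j k) disk := by
  unfold riemannTensor
  refine ((contDiffOn_pd (hq.contDiffOn_christoffel _ _ _) i).sub
    (contDiffOn_pd (hq.contDiffOn_christoffel _ _ _) j)).add (ContDiffOn.sum fun m _ => ?_)
  exact ((hq.contDiffOn_christoffel _ _ _).mul (hq.contDiffOn_christoffel _ _ _)).sub
    ((hq.contDiffOn_christoffel _ _ _).mul (hq.contDiffOn_christoffel _ _ _))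

lemma contDiffOn_gaussCurvature (hq : IsRiemannianMetric q) :
    ContDiffOn ℝ ∞ (gaussCurvature q) disk := by
  unfold gaussCurvature
  refine ContDiffOn.div (ContDiffOn.sum fun l _ => ?_) hq.contDiffOn_det
    fun x hx => (hq.det_pos hx).ne'
  exact (hq.smooth 0 l).mul (hq.contDiffOn_riemannTensor l 0 1 1)

lemma pd_symm (hq : IsRiemannianMetric q) {x : Plane} (hx : x ∈ disk) (k i j : Fin 2) :
    pd k (fun z => q z i j) x = pd k (fun z => q z j i) x :=
  pd_congr (fun _ hz => hq.symm hz i j) hx k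

/-- The Levi-Civita connection is torsion-free. -/
lemma christoffel_symm (hq : IsRiemannianMetric q) {x : Plane} (hx : x ∈ disk) (k i j : Fin 2) :
    christoffel q k i j x = christoffel q k j i x := by
  unfold christoffel
  congr 1
  refine Finset.sum_congr rfl fun l _ => ?_
  rw [hq.pd_symm hx l i j]
  ring

/-- Lowering the index cancels the inverse metric and leaves the Christoffel symbols of the first
kind, of which `pd_metric` is a linear combination. -/
lemma sum_mul_christoffel (hq : IsRiemannianMetric q) {x : Plane} (hx : x ∈ disk) (i j k : Fin 2) :
    q x i 0 * christoffel q 0 k j x + q x i 1 * christoffel q 1 k j x =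
      (1 / 2) * (pd k (fun z => q z j i) x + pd j (fun z => q z k i) x
        - pd i (fun z => q z k j) x) := by
  have h : q x * (q x)⁻¹ = 1 := Matrix.mul_nonsing_inv _ (hq.det_pos hx).ne'.isUnit
  have h' : ∀ l, q x i 0 * (q x)⁻¹ 0 l + q x i 1 * (q x)⁻¹ 1 l = if i = l then 1 else 0 := by
    intro l
    rw [← Matrix.one_apply, ← h, Matrix.mul_apply, Fin.sum_univ_two]
  have h0 := h' 0
  have h1 := h' 1
  simp only [christoffel, Fin.sum_univ_two]
  fin_cases i
  · simp only [Fin.zero_eta, Fin.isValue, reduceIte, zero_ne_one] at h0 h1 ⊢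
    linear_combination (1 / 2) * (pd k (fun z => q z j 0) x + pd j (fun z => q z k 0) x
        - pd 0 (fun z => q z k j) x) * h0 + (1 / 2) * (pd k (fun z => q z j 1) x
        + pd j (fun z => q z k 1) x - pd 1 (fun z => q z k j) x) * h1
  · simp only [Fin.mk_one, Fin.isValue, reduceIte, one_ne_zero] at h0 h1 ⊢
    linear_combination (1 / 2) * (pd k (fun z => q z j 0) x + pd j (fun z => q z k 0) x
        - pd 0 (fun z => q z k j) x) * h0 + (1 / 2) * (pd k (fun z => q z j 1) x
        + pd j (fun z => q z k 1) x - pd 1 (fun z => q z k j) x) * h1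

/-- The Levi-Civita connection is compatible with the metric. -/
lemma pd_metric (hq : IsRiemannianMetric q) {x : Plane} (hx : x ∈ disk) (k i j : Fin 2) :
    pd k (fun z => q z i j) x =
      q x i 0 * christoffel q 0 k j x + q x i 1 * christoffel q 1 k j x +
        (q x j 0 * christoffel q 0 k i x + q x j 1 * christoffel q 1 k i x) := by
  rw [hq.sum_mul_christoffel hx i j k, hq.sum_mul_christoffel hx j i k, hq.pd_symm hx k j i,
    hq.pd_symm hx i k j, hq.pd_symm hx j k i]
  ring

/-- The curvature tensor takes its values in the skew-symmetric endomorphisms. -/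
lemma riemannTensor_skew (hq : IsRiemannianMetric q) {x : Plane} (hx : x ∈ disk) (i j : Fin 2) :
    q x i 0 * riemannTensor q 0 0 1 j x + q x i 1 * riemannTensor q 1 0 1 j x +
      (q x j 0 * riemannTensor q 0 0 1 i x + q x j 1 * riemannTensor q 1 0 1 i x) = 0 := by
  have dq : ∀ i j, DifferentiableAt ℝ (fun z => q z i j) x := fun i j =>
    differentiableAt_of_contDiffOn (hq.smooth i j) hx
  have dc : ∀ k i j, DifferentiableAt ℝ (christoffel q k i j) x := fun k i j =>
    differentiableAt_of_contDiffOn (hq.contDiffOn_christoffel k i j) hx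
  have key : ∀ l k, pd l (pd k (fun z => q z i j)) x =
      pd l (fun z => q z i 0) x * christoffel q 0 k j x + q x i 0 * pd l (christoffel q 0 k j) x +
      (pd l (fun z => q z i 1) x * christoffel q 1 k j x
        + q x i 1 * pd l (christoffel q 1 k j) x) +
      (pd l (fun z => q z j 0) x * christoffel q 0 k i x + q x j 0 * pd l (christoffel q 0 k i) x +
      (pd l (fun z => q z j 1) x * christoffel q 1 k i x
        + q x j 1 * pd l (christoffel q 1 k i) x)) := by
    intro l k
    rw [pd_congr (fun z hz => hq.pd_metric hz k i j) hx l, pd_add, pd_add, pd_add, pd_mul, pd_mul,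
      pd_mul, pd_mul]
    all_goals first | exact dq _ _ | exact dc _ _ _ | skip
    all_goals first
      | exact (dq _ _).mul (dc _ _ _)
      | exact ((dq _ _).mul (dc _ _ _)).add ((dq _ _).mul (dc _ _ _))
  -- The skew-symmetry is the equality of the mixed second derivatives of `q i j`, expanded twice by
  -- metric compatibility.
  have h := pd_comm (hq.smooth i j) hx 0 1
  rw [key, key, hq.pd_metric hx 0 i 0, hq.pd_metric hx 0 i 1, hq.pd_metric hx 0 j 0,
    hq.pd_metric hx 0 j 1, hq.pd_metric hx 1 i 0, hq.pd_metric hx 1 i 1, hq.pd_metric hx 1 j 0,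
    hq.pd_metric hx 1 j 1] at h
  simp only [riemannTensor, Fin.sum_univ_two]
  rw [hq.symm hx 1 0] at *
  fin_cases i <;> fin_cases j <;> simp only [Fin.zero_eta, Fin.mk_one, Fin.isValue] at h ⊢ <;>
    (try rw [hq.symm hx 1 0] at *) <;> linear_combination h

/-- In dimension two the curvature tensor is determined by the Gauss curvature. -/
lemma riemannTensor_eq (hq : IsRiemannianMetric q) {x : Plane} (hx : x ∈ disk) :
    riemannTensor q 0 0 1 0 x = gaussCurvature q x * q x 0 1 ∧
    riemannTensor q 1 0 1 0 x = -(gaussCurvature q x * q x 0 0) ∧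
    riemannTensor q 0 0 1 1 x = gaussCurvature q x * q x 1 1 ∧
    riemannTensor q 1 0 1 1 x = -(gaussCurvature q x * q x 0 1) := by
  have hd := (hq.det_pos hx).ne'
  have h00 := hq.riemannTensor_skew hx 0 0
  have h01 := hq.riemannTensor_skew hx 0 1
  have h11 := hq.riemannTensor_skew hx 1 1
  rw [hq.symm hx 1 0] at h01 h11
  have hK : gaussCurvature q x * (q x).det =
      q x 0 0 * riemannTensor q 0 0 1 1 x + q x 0 1 * riemannTensor q 1 0 1 1 x := by
    rw [gaussCurvature, div_mul_cancel₀ _ hd, Fin.sum_univ_two]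
  have hdet := hq.det_eq hx
  -- The three skew-symmetry relations and the definition of `K` are four linear equations for the
  -- four components.
  refine ⟨?_, ?_, ?_, ?_⟩ <;> apply mul_right_cancel₀ hd
  · linear_combination (riemannTensor q 0 0 1 0 x) * hdet - q x 0 1 * hK - q x 0 1 * h01
      + q x 1 1 * h00 / 2
  · linear_combination (riemannTensor q 1 0 1 0 x) * hdet + q x 0 0 * hK + q x 0 0 * h01
      - q x 0 1 * h00 / 2
  · linear_combination (riemannTensor q 0 0 1 1 x) * hdet - q x 1 1 * hK - q x 0 1 * h11 / 2
  · linear_combination (riemannTensor q 1 0 1 1 x) * hdet + q x 0 1 * hK + q x 0 0 * h11 / 2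

end IsRiemannianMetric

end Metric

/-! ### Covariant derivatives along curves -/

section Covariant

variable {q : Plane → Matrix (Fin 2) (Fin 2) ℝ}

/-- The metric as a bilinear form. -/
def metric (q : Plane → Matrix (Fin 2) (Fin 2) ℝ) (x v w : Plane) : ℝ :=
  ∑ i, ∑ j, q x i j * v i * w j

/-- The bilinear form `Γ(v, w)` of the Levi-Civita connection. -/
noncomputable def conn (q : Plane → Matrix (Fin 2) (Fin 2) ℝ) (x v w : Plane) : Plane :=
  WithLp.toLp 2 fun k => ∑ i, ∑ j, christoffel q k i j x * v i * w j

/-- The derivative of `Γ(v, w)` in the direction `Y`. -/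
noncomputable def dconn (q : Plane → Matrix (Fin 2) (Fin 2) ℝ) (x Y v w : Plane) : Plane :=
  WithLp.toLp 2 fun k => ∑ i, ∑ j,
    (pd 0 (christoffel q k i j) x * Y 0 + pd 1 (christoffel q k i j) x * Y 1) * v i * w j

/-- The rotation by a right angle. -/
noncomputable def rot (q : Plane → Matrix (Fin 2) (Fin 2) ℝ) (x v : Plane) : Plane :=
  WithLp.toLp 2 ![-(q x 0 1 * v 0 + q x 1 1 * v 1) / √(q x).det,
    (q x 0 0 * v 0 + q x 0 1 * v 1) / √(q x).det]

lemma metric_eq (x v w : Plane) : metric q x v w = q x 0 0 * v 0 * w 0 + q x 0 1 * v 0 * w 1 +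
    (q x 1 0 * v 1 * w 0 + q x 1 1 * v 1 * w 1) := by
  simp only [metric, Fin.sum_univ_two]

lemma conn_apply (x v w : Plane) (k : Fin 2) : conn q x v w k =
    christoffel q k 0 0 x * v 0 * w 0 + christoffel q k 0 1 x * v 0 * w 1 +
    (christoffel q k 1 0 x * v 1 * w 0 + christoffel q k 1 1 x * v 1 * w 1) := by
  simp only [conn, Fin.sum_univ_two]

lemma dconn_apply (x Y v w : Plane) (k : Fin 2) : dconn q x Y v w k =
    (pd 0 (christoffel q k 0 0) x * Y 0 + pd 1 (christoffel q k 0 0) x * Y 1) * v 0 * w 0 +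
    (pd 0 (christoffel q k 0 1) x * Y 0 + pd 1 (christoffel q k 0 1) x * Y 1) * v 0 * w 1 +
    ((pd 0 (christoffel q k 1 0) x * Y 0 + pd 1 (christoffel q k 1 0) x * Y 1) * v 1 * w 0 +
    (pd 0 (christoffel q k 1 1) x * Y 0 + pd 1 (christoffel q k 1 1) x * Y 1) * v 1 * w 1) := by
  simp only [dconn, Fin.sum_univ_two]

lemma rot_apply_zero (x v : Plane) :
    rot q x v 0 = -(q x 0 1 * v 0 + q x 1 1 * v 1) / √(q x).det := rfl

lemma rot_apply_one (x v : Plane) :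
    rot q x v 1 = (q x 0 0 * v 0 + q x 0 1 * v 1) / √(q x).det := rfl

lemma conn_add_left (x v v' w : Plane) : conn q x (v + v') w = conn q x v w + conn q x v' w := by
  ext k
  simp only [conn_apply, PiLp.add_apply]
  ring

lemma conn_smul_left (x v w : Plane) (a : ℝ) : conn q x (a • v) w = a • conn q x v w := by
  ext k
  simp only [conn_apply, PiLp.smul_apply, smul_eq_mul]
  ring

lemma conn_neg_left (x v w : Plane) : conn q x (-v) w = -conn q x v w := by
  simpa using conn_smul_left (q := q) x v w (-1)

lemma conn_sub_left (x v v' w : Plane) : conn q x (v - v') w = conn q x v w - conn q x v' w := by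
  rw [sub_eq_add_neg, conn_add_left, conn_neg_left, sub_eq_add_neg]

lemma rot_add (x v w : Plane) : rot q x (v + w) = rot q x v + rot q x w := by
  ext k
  fin_cases k <;> simp [rot_apply_zero, rot_apply_one] <;> ring

lemma rot_smul (x v : Plane) (a : ℝ) : rot q x (a • v) = a • rot q x v := by
  ext k
  fin_cases k <;> simp [rot_apply_zero, rot_apply_one] <;> ring

lemma dconn_smul_left (x Y v w : Plane) (a : ℝ) :
    dconn q x (a • Y) v w = a • dconn q x Y v w := by
  ext k
  simp only [dconn_apply, PiLp.smul_apply, smul_eq_mul]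
  ring

namespace IsRiemannianMetric

lemma conn_symm (hq : IsRiemannianMetric q) {x : Plane} (hx : x ∈ disk) (v w : Plane) :
    conn q x v w = conn q x w v := by
  ext k
  simp only [conn_apply, hq.christoffel_symm hx k 1 0]
  ring

lemma sq_sqrt_det (hq : IsRiemannianMetric q) {x : Plane} (hx : x ∈ disk) :
    √(q x).det ^ 2 = q x 0 0 * q x 1 1 - q x 0 1 ^ 2 := by
  rw [Real.sq_sqrt (hq.det_pos hx).le, hq.det_eq hx]

lemma sqrt_det_pos (hq : IsRiemannianMetric q) {x : Plane} (hx : x ∈ disk) :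
    0 < √(q x).det := Real.sqrt_pos.2 (hq.det_pos hx)

lemma rot_rot (hq : IsRiemannianMetric q) {x : Plane} (hx : x ∈ disk) (v : Plane) :
    rot q x (rot q x v) = -v := by
  have h := hq.sq_sqrt_det hx
  have hs := (hq.sqrt_det_pos hx).ne'
  ext k
  fin_cases k
  · simp only [Fin.zero_eta, Fin.isValue, rot_apply_zero, rot_apply_one, PiLp.neg_apply]
    field_simp
    linear_combination v 0 * h
  · simp only [Fin.mk_one, Fin.isValue, rot_apply_zero, rot_apply_one, PiLp.neg_apply]
    field_simp
    linear_combination v 1 * h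

lemma metric_rot_rot (hq : IsRiemannianMetric q) {x : Plane} (hx : x ∈ disk) (v : Plane) :
    metric q x (rot q x v) (rot q x v) = metric q x v v := by
  have h := hq.sq_sqrt_det hx
  have hs := (hq.sqrt_det_pos hx).ne'
  simp only [metric_eq, rot_apply_zero, rot_apply_one, hq.symm hx 1 0]
  field_simp
  linear_combination (-(q x 0 0 * v 0 ^ 2 + 2 * q x 0 1 * v 0 * v 1 + q x 1 1 * v 1 ^ 2)) * h

lemma metric_rot (hq : IsRiemannianMetric q) {x : Plane} (hx : x ∈ disk) (v : Plane) :
    metric q x v (rot q x v) = 0 := by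
  have hs := (hq.sqrt_det_pos hx).ne'
  simp only [metric_eq, rot_apply_zero, rot_apply_one, hq.symm hx 1 0]
  field_simp
  ring

lemma hasDerivWithinAt_coeff (hq : IsRiemannianMetric q) {x : ℝ → Plane} {Y : Plane} {s : Set ℝ}
    {t : ℝ} (hx : x t ∈ disk) (hY : HasDerivWithinAt x Y s t) (i j : Fin 2) :
    HasDerivWithinAt (fun t => q (x t) i j)
      ((q (x t) i 0 * christoffel q 0 0 j (x t) + q (x t) i 1 * christoffel q 1 0 j (x t) +
        (q (x t) j 0 * christoffel q 0 0 i (x t) + q (x t) j 1 * christoffel q 1 0 i (x t))) * Y 0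
      + (q (x t) i 0 * christoffel q 0 1 j (x t) + q (x t) i 1 * christoffel q 1 1 j (x t) +
        (q (x t) j 0 * christoffel q 0 1 i (x t) + q (x t) j 1 * christoffel q 1 1 i (x t))) * Y 1)
      s t := by
  rw [← hq.pd_metric hx, ← hq.pd_metric hx]
  exact hasDerivWithinAt_comp_curve (differentiableAt_of_contDiffOn (hq.smooth i j) hx) hY

/-- `V + conn q x Y v` is the covariant derivative of `v` along the curve, here and below; this is
metric compatibility in that language. -/
lemma hasDerivWithinAt_metric (hq : IsRiemannianMetric q) {x v w : ℝ → Plane} {Y V W : Plane}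
    {s : Set ℝ} {t : ℝ} (hx : x t ∈ disk) (hY : HasDerivWithinAt x Y s t)
    (hv : HasDerivWithinAt v V s t) (hw : HasDerivWithinAt w W s t) :
    HasDerivWithinAt (fun t => metric q (x t) (v t) (w t))
      (metric q (x t) (V + conn q (x t) Y (v t)) (w t) +
        metric q (x t) (v t) (W + conn q (x t) Y (w t))) s t := by
  simp only [metric_eq]
  have hc := hq.hasDerivWithinAt_coeff hx hY
  have hv := hasDerivWithinAt_coord hv
  have hw := hasDerivWithinAt_coord hw
  refine (((((hc 0 0).mul (hv 0)).mul (hw 0)).add (((hc 0 1).mul (hv 0)).mul (hw 1))).add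
    ((((hc 1 0).mul (hv 1)).mul (hw 0)).add (((hc 1 1).mul (hv 1)).mul (hw 1)))).congr_deriv ?_
  simp only [conn_apply, PiLp.add_apply, hq.symm hx 1 0, Pi.mul_apply]
  ring

/-- The trace of the connection is the logarithmic derivative of the area density, which is the
denominator of `rot`. -/
lemma hasDerivWithinAt_sqrt_det (hq : IsRiemannianMetric q) {x : ℝ → Plane} {Y : Plane}
    {s : Set ℝ} {t : ℝ} (hx : x t ∈ disk) (hY : HasDerivWithinAt x Y s t) :
    HasDerivWithinAt (fun t => √(q (x t)).det)
      (√(q (x t)).det * ((christoffel q 0 0 0 (x t) + christoffel q 1 0 1 (x t)) * Y 0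
        + (christoffel q 0 1 0 (x t) + christoffel q 1 1 1 (x t)) * Y 1)) s t := by
  have hc := hq.hasDerivWithinAt_coeff hx hY
  have hd := (((hc 0 0).mul (hc 1 1)).sub ((hc 0 1).mul (hc 1 0))).congr
    (f₁ := fun t => (q (x t)).det) (fun _ _ => Matrix.det_fin_two _) (Matrix.det_fin_two _)
  refine (hd.sqrt (hq.det_pos hx).ne').congr_deriv ?_
  have h := hq.sq_sqrt_det hx
  have hs := (hq.sqrt_det_pos hx).ne'
  simp only [hq.symm hx 1 0]
  field_simp
  rw [h]
  ring

/-- The rotation by a right angle is parallel. -/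
lemma hasDerivWithinAt_rot (hq : IsRiemannianMetric q) {x v : ℝ → Plane} {Y V : Plane}
    {s : Set ℝ} {t : ℝ} (hx : x t ∈ disk) (hY : HasDerivWithinAt x Y s t)
    (hv : HasDerivWithinAt v V s t) :
    HasDerivWithinAt (fun t => rot q (x t) (v t))
      (rot q (x t) (V + conn q (x t) Y (v t)) - conn q (x t) Y (rot q (x t) (v t))) s t := by
  have hc := hq.hasDerivWithinAt_coeff hx hY
  have hv := hasDerivWithinAt_coord hv
  have hd := hq.hasDerivWithinAt_sqrt_det hx hY
  have h := hq.sq_sqrt_det hx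
  have hs := (hq.sqrt_det_pos hx).ne'
  refine hasDerivWithinAt_of_coord fun k => ?_
  fin_cases k
  · refine (((((hc 0 1).mul (hv 0)).add ((hc 1 1).mul (hv 1))).neg).div hd hs).congr_deriv ?_
    simp only [conn_apply, PiLp.add_apply, PiLp.sub_apply, rot_apply_zero, rot_apply_one,
      hq.symm hx 1 0, Fin.zero_eta, Pi.mul_apply, Pi.add_apply, Pi.neg_apply]
    field_simp
    ring
  · refine ((((hc 0 0).mul (hv 0)).add ((hc 0 1).mul (hv 1))).div hd hs).congr_deriv ?_
    simp only [conn_apply, PiLp.add_apply, PiLp.sub_apply, rot_apply_zero, rot_apply_one,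
      hq.symm hx 1 0, Fin.mk_one, Pi.mul_apply, Pi.add_apply]
    field_simp
    ring

lemma hasDerivWithinAt_conn (hq : IsRiemannianMetric q) {x v w : ℝ → Plane} {Y V W : Plane}
    {s : Set ℝ} {t : ℝ} (hx : x t ∈ disk) (hY : HasDerivWithinAt x Y s t)
    (hv : HasDerivWithinAt v V s t) (hw : HasDerivWithinAt w W s t) :
    HasDerivWithinAt (fun t => conn q (x t) (v t) (w t))
      (dconn q (x t) Y (v t) (w t) + conn q (x t) V (w t) + conn q (x t) (v t) W) s t := by
  refine hasDerivWithinAt_of_coord fun k => ?_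
  simp only [conn_apply]
  have hc : ∀ i j, HasDerivWithinAt (fun t => christoffel q k i j (x t)) _ s t := fun i j =>
    hasDerivWithinAt_comp_curve
      (differentiableAt_of_contDiffOn (hq.contDiffOn_christoffel k i j) hx) hY
  have hv := hasDerivWithinAt_coord hv
  have hw := hasDerivWithinAt_coord hw
  refine (((((hc 0 0).mul (hv 0)).mul (hw 0)).add (((hc 0 1).mul (hv 0)).mul (hw 1))).add
    ((((hc 1 0).mul (hv 1)).mul (hw 0)).add (((hc 1 1).mul (hv 1)).mul (hw 1)))).congr_deriv ?_
  simp only [conn_apply, dconn_apply, PiLp.add_apply, Pi.mul_apply]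
  ring

/-- The curvature term of the Jacobi equation. -/
lemma curvature_rot (hq : IsRiemannianMetric q) {x v : Plane} (hx : x ∈ disk)
    (hv : metric q x v v = 1) :
    dconn q x (rot q x v) v v - dconn q x v (rot q x v) v
      + conn q x (rot q x v) (conn q x v v) - conn q x v (conn q x (rot q x v) v) =
    gaussCurvature q x • rot q x v := by
  have hs := (hq.sqrt_det_pos hx).ne'
  obtain ⟨h1, h2, h3, h4⟩ := hq.riemannTensor_eq hx
  have hN : rot q x v 0 * v 1 - rot q x v 1 * v 0 = -1 / √(q x).det := by
    rw [rot_apply_zero, rot_apply_one]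
    rw [metric_eq, hq.symm hx 1 0] at hv
    field_simp
    linear_combination -hv
  -- The left side is `R(rot v, v) v`. In dimension two it is `R(∂₀, ∂₁) v` times the coordinate
  -- determinant of `(rot v, v)`, which `hN` evaluates.
  have hR : ∀ k, (dconn q x (rot q x v) v v - dconn q x v (rot q x v) v
      + conn q x (rot q x v) (conn q x v v) - conn q x v (conn q x (rot q x v) v)) k =
      (rot q x v 0 * v 1 - rot q x v 1 * v 0) *
        (riemannTensor q k 0 1 0 x * v 0 + riemannTensor q k 0 1 1 x * v 1) := by
    intro k
    simp only [PiLp.sub_apply, PiLp.add_apply, dconn_apply, conn_apply, riemannTensor,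
      Fin.sum_univ_two]
    ring
  ext k
  rw [hR, hN]
  fin_cases k
  · simp only [Fin.zero_eta, Fin.isValue, h1, h3, PiLp.smul_apply, smul_eq_mul, rot_apply_zero]
    ring
  · simp only [Fin.mk_one, Fin.isValue, h2, h4, PiLp.smul_apply, smul_eq_mul, rot_apply_one]
    ring

end IsRiemannianMetric

/-! ### Geodesics and Jacobi fields -/

/-- The vector field of the geodesic flow. -/
noncomputable def geodesicField (q : Plane → Matrix (Fin 2) (Fin 2) ℝ) (p : Plane × Plane) :
    Plane × Plane :=
  (p.2, -conn q p.1 p.2 p.2)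

namespace IsRiemannianMetric

lemma contDiffOn_geodesicField (hq : IsRiemannianMetric q) :
    ContDiffOn ℝ ∞ (geodesicField q) (disk ×ˢ univ) := by
  refine contDiffOn_snd.prodMk (ContDiffOn.neg ?_)
  rw [contDiffOn_euclidean]
  intro k
  have hc : ∀ i j, ContDiffOn ℝ ∞ (fun p : Plane × Plane => christoffel q k i j p.1)
      (disk ×ˢ univ) := fun i j =>
    (hq.contDiffOn_christoffel k i j).comp contDiffOn_fst fun p hp => hp.1
  have hv : ∀ i, ContDiffOn ℝ ∞ (fun p : Plane × Plane => p.2 i) (disk ×ˢ univ) := fun i =>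
    (contDiffOn_euclidean.1 contDiffOn_snd i)
  simp only [conn_apply]
  exact ((((hc 0 0).mul (hv 0)).mul (hv 0)).add (((hc 0 1).mul (hv 0)).mul (hv 1))).add
    ((((hc 1 0).mul (hv 1)).mul (hv 0)).add (((hc 1 1).mul (hv 1)).mul (hv 1)))

/-- The derivative along the line `t ↦ (x + t Y, v + t W)` is computed in two ways. -/
lemma fderiv_geodesicField (hq : IsRiemannianMetric q) {x : Plane} (hx : x ∈ disk)
    (v Y W : Plane) : fderiv ℝ (geodesicField q) (x, v) (Y, W) =
      (W, -(dconn q x Y v v + conn q x W v + conn q x v W)) := by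
  have hd : DifferentiableAt ℝ (geodesicField q) (x, v) :=
    (hq.contDiffOn_geodesicField.contDiffAt
      (prod_mem_nhds (isOpen_disk.mem_nhds hx) univ_mem)).differentiableAt (by simp)
  have hY : HasDerivWithinAt (fun t : ℝ => x + t • Y) Y univ 0 :=
    ((((hasDerivAt_id (0 : ℝ)).smul_const Y).const_add x).congr_deriv (by simp)).hasDerivWithinAt
  have hW : HasDerivWithinAt (fun t : ℝ => v + t • W) W univ 0 :=
    ((((hasDerivAt_id (0 : ℝ)).smul_const W).const_add v).congr_deriv (by simp)).hasDerivWithinAt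
  have hx0 : x + (0 : ℝ) • Y = x := by simp
  have hv0 : v + (0 : ℝ) • W = v := by simp
  have h1 : HasDerivWithinAt (fun t : ℝ => geodesicField q (x + t • Y, v + t • W))
      (fderiv ℝ (geodesicField q) (x, v) (Y, W)) univ 0 := by
    have hd' : HasFDerivAt (geodesicField q) (fderiv ℝ (geodesicField q) (x, v))
        (x + (0 : ℝ) • Y, v + (0 : ℝ) • W) := by
      rw [hx0, hv0]
      exact hd.hasFDerivAt
    exact hd'.comp_hasDerivWithinAt (0 : ℝ) (hY.prodMk hW)
  have h2 := hW.prodMk (hq.hasDerivWithinAt_conn (x := fun t : ℝ => x + t • Y)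
    (by simpa using hx) hY hW hW).neg
  simp only [hx0, hv0] at h2
  exact (h1.hasDerivAt univ_mem).unique (h2.hasDerivAt univ_mem)

/-- A normal Jacobi field along a geodesic solves the linearized geodesic equation. -/
lemma hasDerivWithinAt_jacobi (hq : IsRiemannianMetric q) {x v : ℝ → Plane} {J P : ℝ → ℝ}
    {s : Set ℝ} {t : ℝ} (hx : x t ∈ disk) (hxd : HasDerivWithinAt x (v t) s t)
    (hvd : HasDerivWithinAt v (-conn q (x t) (v t) (v t)) s t)
    (hJ : HasDerivWithinAt J (P t) s t)
    (hP : HasDerivWithinAt P (-gaussCurvature q (x t) * J t) s t)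
    (hv : metric q (x t) (v t) (v t) = 1) :
    HasDerivWithinAt (fun t => (J t • rot q (x t) (v t),
        P t • rot q (x t) (v t) - J t • conn q (x t) (rot q (x t) (v t)) (v t)))
      (fderiv ℝ (geodesicField q) (x t, v t) (J t • rot q (x t) (v t),
        P t • rot q (x t) (v t) - J t • conn q (x t) (rot q (x t) (v t)) (v t))) s t := by
  -- The normal is parallel along the geodesic. The second component of the field is its covariant
  -- derivative `P N`, less the connection term that converts it into a coordinate derivative.
  have hN : HasDerivWithinAt (fun t => rot q (x t) (v t))
      (-conn q (x t) (v t) (rot q (x t) (v t))) s t := by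
    refine (hq.hasDerivWithinAt_rot hx hxd hvd).congr_deriv ?_
    rw [neg_add_cancel]
    have : rot q (x t) 0 = 0 := by simpa using rot_smul (q := q) (x t) 0 0
    rw [this, zero_sub]
  rw [hq.fderiv_geodesicField hx]
  refine ((hJ.smul hN).prodMk ((hP.smul hN).sub
    (hJ.smul (hq.hasDerivWithinAt_conn hx hxd hN hvd)))).congr_deriv (Prod.ext ?_ ?_)
  · simp only [hq.conn_symm hx (v t) (rot q (x t) (v t))]
    module
  · have hcurv := hq.curvature_rot hx hv
    have hneg : ∀ a b : Plane, conn q (x t) a (-b) = -conn q (x t) a b := fun a b => by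
      rw [hq.conn_symm hx, conn_neg_left, hq.conn_symm hx]
    simp only [hneg, conn_neg_left, conn_sub_left, conn_smul_left, dconn_smul_left,
      hq.conn_symm hx (v t) (P t • rot q (x t) (v t)
        - J t • conn q (x t) (rot q (x t) (v t)) (v t)),
      hq.conn_symm hx (v t) (rot q (x t) (v t)),
      hq.conn_symm hx (v t) (conn q (x t) (rot q (x t) (v t)) (v t))] at hcurv ⊢
    linear_combination (norm := module) J t • hcurv

end IsRiemannianMetric

end Covariant

/-! ### The Hessian -/

section Hessian

variable {q : Plane → Matrix (Fin 2) (Fin 2) ℝ} {u : Plane → ℝ}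

/-- The differential of `u`. -/
noncomputable def du (u : Plane → ℝ) (x v : Plane) : ℝ := pd 0 u x * v 0 + pd 1 u x * v 1

/-- The Hessian `∇du`. -/
noncomputable def hess (q : Plane → Matrix (Fin 2) (Fin 2) ℝ) (u : Plane → ℝ)
    (x v w : Plane) : ℝ :=
  ∑ i, ∑ j, (pd i (pd j u) x - ∑ k, christoffel q k i j x * pd k u x) * v i * w j

lemma hess_eq (x v w : Plane) : hess q u x v w =
    pd 0 (pd 0 u) x * v 0 * w 0 + pd 0 (pd 1 u) x * v 0 * w 1 +
    (pd 1 (pd 0 u) x * v 1 * w 0 + pd 1 (pd 1 u) x * v 1 * w 1) - du u x (conn q x v w) := by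
  simp only [hess, du, conn_apply, Fin.sum_univ_two]
  ring

lemma hess_smul_left (x v w : Plane) (a : ℝ) :
    hess q u x (a • v) w = a * hess q u x v w := by
  simp only [hess, PiLp.smul_apply, smul_eq_mul, Finset.mul_sum]
  refine Finset.sum_congr rfl fun i _ => Finset.sum_congr rfl fun j _ => ?_
  ring

lemma hasDerivWithinAt_du (hu : ContDiffOn ℝ ∞ u disk) {x v : ℝ → Plane} {Y V : Plane}
    {s : Set ℝ} {t : ℝ} (hx : x t ∈ disk) (hY : HasDerivWithinAt x Y s t)
    (hv : HasDerivWithinAt v V s t) :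
    HasDerivWithinAt (fun t => du u (x t) (v t))
      (hess q u (x t) Y (v t) + du u (x t) (V + conn q (x t) Y (v t))) s t := by
  have hv := hasDerivWithinAt_coord hv
  have hd : ∀ i, HasDerivWithinAt (fun t => pd i u (x t)) _ s t := fun i =>
    hasDerivWithinAt_comp_curve (differentiableAt_of_contDiffOn (contDiffOn_pd hu i) hx) hY
  refine (((hd 0).mul (hv 0)).add ((hd 1).mul (hv 1))).congr_deriv ?_
  simp only [hess_eq, du, PiLp.add_apply]
  ring

/-- The derivative along a geodesic of `J` times the radial derivative of `u`. -/
lemma hasDerivWithinAt_mul_du (hu : ContDiffOn ℝ ∞ u disk)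
    {x v : ℝ → Plane} {J : ℝ → ℝ} {P : ℝ} {s : Set ℝ} {t : ℝ} (hx : x t ∈ disk)
    (hxd : HasDerivWithinAt x (v t) s t)
    (hvd : HasDerivWithinAt v (-conn q (x t) (v t) (v t)) s t) (hJ : HasDerivWithinAt J P s t) :
    HasDerivWithinAt (fun t => J t * du u (x t) (v t))
      (P * du u (x t) (v t) + J t * hess q u (x t) (v t) (v t)) s t := by
  refine (hJ.mul (hasDerivWithinAt_du (q := q) hu hx hxd hvd)).congr_deriv ?_
  rw [neg_add_cancel]
  simp [du]

namespace IsRiemannianMetric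

/-- The inverse metric in the orthonormal frame `v, rot v`. -/
lemma inv_apply_eq (hq : IsRiemannianMetric q) {x v : Plane} (hx : x ∈ disk)
    (hv : metric q x v v = 1) (i j : Fin 2) :
    (q x)⁻¹ i j = v i * v j + rot q x v i * rot q x v j := by
  have h := hq.sq_sqrt_det hx
  have hs := (hq.sqrt_det_pos hx).ne'
  have hd := (hq.det_pos hx).ne'
  rw [metric_eq, hq.symm hx 1 0] at hv
  rw [inv_eq_smul_adjugate, Matrix.smul_apply, Matrix.adjugate_fin_two, hq.det_eq hx, ← h]
  fin_cases i <;> fin_cases j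
  · simp [rot_apply_zero]
    field_simp
    linear_combination (-q x 1 1) * hv - v 0 ^ 2 * h
  · simp [rot_apply_zero, rot_apply_one]
    field_simp
    linear_combination (q x 0 1) * hv - v 0 * v 1 * h
  · simp [rot_apply_zero, rot_apply_one, hq.symm hx 1 0]
    field_simp
    linear_combination (q x 0 1) * hv - v 0 * v 1 * h
  · simp [rot_apply_one]
    field_simp
    linear_combination (-q x 0 0) * hv - v 1 ^ 2 * h

/-- The Laplacian is the trace of the Hessian in the orthonormal frame `v, rot v`. -/
lemma laplacian_eq (hq : IsRiemannianMetric q) {x v : Plane} (hx : x ∈ disk)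
    (hv : metric q x v v = 1) :
    laplacian q u x = hess q u x v v + hess q u x (rot q x v) (rot q x v) := by
  simp only [laplacian, hess, hq.inv_apply_eq hx hv, ← Finset.sum_add_distrib]
  refine Finset.sum_congr rfl fun i _ => Finset.sum_congr rfl fun j _ => ?_
  ring

lemma abs_du_le_normDiff (hq : IsRiemannianMetric q) {x v : Plane} (hx : x ∈ disk)
    (hv : metric q x v v = 1) : |du u x v| ≤ normDiff q u x := by
  rw [normDiff]
  refine Real.abs_le_sqrt ?_
  simp only [hq.inv_apply_eq hx hv, Fin.sum_univ_two, du]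
  nlinarith [sq_nonneg (pd 0 u x * rot q x v 0 + pd 1 u x * rot q x v 1)]

/-- The angular derivative of the normal derivative of `u` in geodesic polar coordinates. -/
lemma hasDerivWithinAt_du_rot (hq : IsRiemannianMetric q) (hu : ContDiffOn ℝ ∞ u disk)
    {x v : ℝ → Plane} {J P : ℝ} {s : Set ℝ} {θ : ℝ} (hx : x θ ∈ disk)
    (hxd : HasDerivWithinAt x (J • rot q (x θ) (v θ)) s θ)
    (hvd : HasDerivWithinAt v
      (P • rot q (x θ) (v θ) - J • conn q (x θ) (rot q (x θ) (v θ)) (v θ)) s θ) :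
    HasDerivWithinAt (fun θ => du u (x θ) (rot q (x θ) (v θ)))
      (J * hess q u (x θ) (rot q (x θ) (v θ)) (rot q (x θ) (v θ)) - P * du u (x θ) (v θ)) s θ := by
  refine (hasDerivWithinAt_du (q := q) hu hx hxd
    (hq.hasDerivWithinAt_rot hx hxd hvd)).congr_deriv ?_
  -- The covariant derivative of `v` in `θ` is `P • rot v`, so that of `rot v` is `-P • v`: hence
  -- the term `-P * du v`.
  rw [conn_smul_left, sub_add_cancel, sub_add_cancel, rot_smul, hq.rot_rot hx, hess_smul_left]
  simp only [du, PiLp.smul_apply, PiLp.neg_apply, smul_eq_mul]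
  ring

end IsRiemannianMetric

end Hessian

/-! ### Geodesic polar coordinates -/

section Polar

variable {q : Plane → Matrix (Fin 2) (Fin 2) ℝ}

/-- The phase space of the pairs of a geodesic and of a normal Jacobi field along it: the position
and velocity of the geodesic, and the normal component of the Jacobi field and its derivative. -/
abbrev JacobiSpace := (Plane × Plane) × (ℝ × ℝ)

/-- The part of the phase space above the disk. -/
def jacobiDomain : Set JacobiSpace := (disk ×ˢ univ) ×ˢ univ

/-- The vector field whose solutions are geodesics with normal Jacobi fields along them. -/
noncomputable def jacobiField (q : Plane → Matrix (Fin 2) (Fin 2) ℝ) (z : JacobiSpace) :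
    JacobiSpace :=
  (geodesicField q z.1, (z.2.2, -gaussCurvature q z.1.1 * z.2.1))

lemma isOpen_jacobiDomain : IsOpen jacobiDomain :=
  (isOpen_disk.prod isOpen_univ).prod isOpen_univ

lemma IsRiemannianMetric.contDiffOn_jacobiField (hq : IsRiemannianMetric q) :
    ContDiffOn ℝ 1 (jacobiField q) jacobiDomain := by
  refine ContDiffOn.of_le (n := ∞) ?_ (by simp)
  refine (hq.contDiffOn_geodesicField.comp contDiffOn_fst fun z hz => hz.1).prodMk
    ((contDiff_snd.comp contDiff_snd).contDiffOn.prodMk (ContDiffOn.mul ?_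
      (contDiff_fst.comp contDiff_snd).contDiffOn))
  exact (hq.contDiffOn_gaussCurvature.comp (contDiff_fst.comp contDiff_fst).contDiffOn
    fun z hz => hz.1.1).neg

lemma hasDerivWithinAt_fst {E F : Type*} [NormedAddCommGroup E] [NormedSpace ℝ E]
    [NormedAddCommGroup F] [NormedSpace ℝ F] {z : ℝ → E × F} {z' : E × F} {s : Set ℝ} {t : ℝ}
    (h : HasDerivWithinAt z z' s t) : HasDerivWithinAt (fun t => (z t).1) z'.1 s t :=
  (ContinuousLinearMap.fst ℝ E F).hasFDerivAt.comp_hasDerivWithinAt t h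

lemma hasDerivWithinAt_snd {E F : Type*} [NormedAddCommGroup E] [NormedSpace ℝ E]
    [NormedAddCommGroup F] [NormedSpace ℝ F] {z : ℝ → E × F} {z' : E × F} {s : Set ℝ} {t : ℝ}
    (h : HasDerivWithinAt z z' s t) : HasDerivWithinAt (fun t => (z t).2) z'.2 s t :=
  (ContinuousLinearMap.snd ℝ E F).hasFDerivAt.comp_hasDerivWithinAt t h

/-! ### Speed of the geodesics and growth of their Jacobi fields -/

section Solution

variable {z : ℝ → JacobiSpace} {T : ℝ}

lemma IsSol.mem_disk (hz : IsSol (jacobiField q) jacobiDomain z T) {t : ℝ} (ht : t ∈ Icc 0 T) :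
    (z t).1.1 ∈ disk := (hz.mem ht).1.1

lemma IsSol.deriv_pos (hz : IsSol (jacobiField q) jacobiDomain z T) {t : ℝ} (ht : t ∈ Icc 0 T) :
    HasDerivWithinAt (fun t => (z t).1.1) (z t).1.2 (Icc 0 T) t :=
  hasDerivWithinAt_fst (hasDerivWithinAt_fst (hz t ht).2)

lemma IsSol.deriv_vel (hz : IsSol (jacobiField q) jacobiDomain z T) {t : ℝ} (ht : t ∈ Icc 0 T) :
    HasDerivWithinAt (fun t => (z t).1.2) (-conn q (z t).1.1 (z t).1.2 (z t).1.2) (Icc 0 T) t :=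
  hasDerivWithinAt_snd (hasDerivWithinAt_fst (hz t ht).2)

lemma IsSol.deriv_jacobi (hz : IsSol (jacobiField q) jacobiDomain z T) {t : ℝ}
    (ht : t ∈ Icc 0 T) : HasDerivWithinAt (fun t => (z t).2.1) (z t).2.2 (Icc 0 T) t :=
  hasDerivWithinAt_fst (hasDerivWithinAt_snd (hz t ht).2)

lemma IsSol.deriv_jacobi_deriv (hz : IsSol (jacobiField q) jacobiDomain z T) {t : ℝ}
    (ht : t ∈ Icc 0 T) : HasDerivWithinAt (fun t => (z t).2.2)
      (-gaussCurvature q (z t).1.1 * (z t).2.1) (Icc 0 T) t :=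
  hasDerivWithinAt_snd (hasDerivWithinAt_snd (hz t ht).2)

/-- Geodesics have constant speed. -/
lemma IsSol.metric_eq_one (hq : IsRiemannianMetric q)
    (hz : IsSol (jacobiField q) jacobiDomain z T)
    (h0 : metric q (z 0).1.1 (z 0).1.2 (z 0).1.2 = 1) {t : ℝ} (ht : t ∈ Icc 0 T) :
    metric q (z t).1.1 (z t).1.2 (z t).1.2 = 1 := by
  have hd : ∀ t ∈ Icc 0 T, HasDerivWithinAt
      (fun t => metric q (z t).1.1 (z t).1.2 (z t).1.2) 0 (Icc 0 T) t := fun t ht => by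
    refine (hq.hasDerivWithinAt_metric (x := fun t => (z t).1.1) (v := fun t => (z t).1.2)
      (w := fun t => (z t).1.2) (hz.mem_disk ht) (hz.deriv_pos ht) (hz.deriv_vel ht)
      (hz.deriv_vel ht)).congr_deriv ?_
    rw [neg_add_cancel]
    simp [metric]
  rw [← h0]
  exact constant_of_has_deriv_right_zero (fun t ht => (hd t ht).continuousWithinAt)
    (fun t ht => hasDerivWithinAt_Ici_of_Icc (hd t (Ico_subset_Icc_self ht)) ht) t ht

/-- The Jacobi field grows at most exponentially when the curvature is bounded. -/
lemma IsSol.norm_jacobi_le (hK : ∀ x ∈ disk, gaussCurvature q x ∈ Icc (-1) 0)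
    (hz : IsSol (jacobiField q) jacobiDomain z T) (h0 : (z 0).2 = (0, 1)) {t : ℝ}
    (ht : t ∈ Icc 0 T) : ‖(z t).2‖ ≤ Real.exp t := by
  have hd : ∀ t ∈ Icc 0 T, HasDerivWithinAt (fun t => (z t).2)
      ((z t).2.2, -gaussCurvature q (z t).1.1 * (z t).2.1) (Icc 0 T) t := fun t ht =>
    (hz.deriv_jacobi ht).prodMk (hz.deriv_jacobi_deriv ht)
  have := norm_le_gronwallBound_of_norm_deriv_right_le (δ := 1) (K := 1) (ε := 0)
    (fun t ht => (hd t ht).continuousWithinAt)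
    (fun t ht => hasDerivWithinAt_Ici_of_Icc (hd t (Ico_subset_Icc_self ht)) ht)
    (by simp [h0, Prod.norm_def]) (fun t ht => ?_) t ht
  · simpa [gronwallBound_ε0] using this
  · have hk := hK _ (hz.mem_disk (Ico_subset_Icc_self ht))
    rw [one_mul, add_zero, Prod.norm_def, Prod.norm_def]
    refine max_le (le_max_right _ _) (le_max_of_le_left ?_)
    rw [norm_mul, norm_neg]
    refine mul_le_of_le_one_left (norm_nonneg _) ?_
    rw [Real.norm_eq_abs, abs_le]
    exact ⟨hk.1, hk.2.trans zero_le_one⟩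

/-- In nonpositive curvature, normal Jacobi fields grow at least as in the flat plane. -/
lemma IsSol.le_jacobi (hK : ∀ x ∈ disk, gaussCurvature q x ≤ 0)
    (hz : IsSol (jacobiField q) jacobiDomain z T) (h0 : (z 0).2 = (0, 1)) {t : ℝ}
    (ht : t ∈ Icc 0 T) : t ≤ (z t).2.1 ∧ 1 ≤ (z t).2.2 := by
  have hmono : ∀ (f f' : ℝ → ℝ), (∀ t ∈ Icc 0 T, HasDerivWithinAt f (f' t) (Icc 0 T) t) →
      (∀ t ∈ Icc 0 T, 0 ≤ f' t) → ∀ t ∈ Icc 0 T, f 0 ≤ f t := by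
    intro f f' hf hf' t ht
    have hm : MonotoneOn f (Icc 0 T) := by
      refine monotoneOn_of_hasDerivWithinAt_nonneg (convex_Icc 0 T)
        (fun t ht => (hf t ht).continuousWithinAt)
        (fun t ht => (hf t (interior_subset ht)).mono interior_subset)
        (fun t ht => hf' t (interior_subset ht))
    exact hm ⟨le_rfl, ht.1.trans ht.2⟩ ht ht.1
  -- The sign of `J` is not known beforehand, so products are used: `(J P)' = P² - K J² ≥ 0`, then
  -- `(P²)' = -2 K J P ≥ 0`. Thus `P² ≥ 1`, and by continuity `P` cannot pass through `0`.
  have hJP : ∀ t ∈ Icc 0 T, 0 ≤ (z t).2.1 * (z t).2.2 := fun t ht => by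
    have := hmono _ _ (fun t ht => (hz.deriv_jacobi ht).mul (hz.deriv_jacobi_deriv ht))
      (fun t ht => ?_) t ht
    · simpa [h0] using this
    · have := hK _ (hz.mem_disk ht)
      nlinarith [mul_self_nonneg (z t).2.2,
        mul_nonneg (neg_nonneg.2 this) (mul_self_nonneg (z t).2.1)]
  have hP2 : ∀ t ∈ Icc 0 T, 1 ≤ (z t).2.2 * (z t).2.2 := fun t ht => by
    have := hmono _ _ (fun t ht => (hz.deriv_jacobi_deriv ht).mul (hz.deriv_jacobi_deriv ht))
      (fun t ht => ?_) t ht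
    · simpa [h0] using this
    · have := hK _ (hz.mem_disk ht)
      nlinarith [mul_nonneg (neg_nonneg.2 this) (hJP t ht)]
  have hPc : ContinuousOn (fun t => (z t).2.2) (Icc 0 T) := fun t ht =>
    (hz.deriv_jacobi_deriv ht).continuousWithinAt
  have hP : ∀ t ∈ Icc 0 T, 1 ≤ (z t).2.2 := fun t ht => by
    by_contra! hlt
    have hneg : (z t).2.2 ≤ 0 := by nlinarith [hP2 t ht]
    obtain ⟨s, hs, hs0⟩ := intermediate_value_Icc' ht.1
      (hPc.mono (Icc_subset_Icc_right ht.2)) (show (0 : ℝ) ∈ Icc _ _ from ⟨hneg, by simp [h0]⟩)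
    have := hP2 s ⟨hs.1, hs.2.trans ht.2⟩
    simp only at hs0
    rw [hs0] at this
    norm_num at this
  refine ⟨?_, hP t ht⟩
  have := hmono _ _ (fun t ht => (hz.deriv_jacobi ht).sub (hasDerivWithinAt_id t _))
    (fun t ht => by linarith [hP t ht]) t ht
  simp [h0] at this
  linarith

end Solution

/-- The distance from the origin of a unit speed curve is at most the time. -/
lemma riemDist_le_of_unit_speed {x v : ℝ → Plane} {T : ℝ} (hT : 0 ≤ T)
    (hx : ∀ t ∈ Icc 0 T, x t ∈ disk) (hxd : ∀ t ∈ Icc 0 T, HasDerivWithinAt x (v t) (Icc 0 T) t)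
    (hv : ContinuousOn v (Icc 0 T)) (h1 : ∀ t ∈ Icc 0 T, metric q (x t) (v t) (v t) = 1) :
    riemDist q (x 0) (x T) ≤ T := by
  have hmaps : MapsTo (fun s : ℝ => T * s) (Icc 0 1) (Icc 0 T) := fun s hs =>
    ⟨mul_nonneg hT hs.1, mul_le_of_le_one_right hT hs.2⟩
  -- `riemDist` asks for curves that are `C¹` on all of `ℝ`: the rescaled velocity is extended by
  -- constants beyond `[0, 1]` and integrated.
  set g : ℝ → Plane := IccExtend (zero_le_one' ℝ) (fun s : Icc (0 : ℝ) 1 => T • v (T * s)) with hg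
  have hgc : Continuous g := by
    rw [hg, continuous_IccExtend_iff]
    exact (hv.comp_continuous (f := fun s : Icc (0 : ℝ) 1 => T * (s : ℝ))
      (by fun_prop) fun s => hmaps s.2).const_smul T
  have hg_eq : ∀ s ∈ Icc (0 : ℝ) 1, g s = T • v (T * s) := fun s hs =>
    IccExtend_of_mem _ _ hs
  set γ : ℝ → Plane := fun s => x 0 + ∫ τ in (0 : ℝ)..s, g τ with hγ
  have hγd : ∀ s, HasDerivAt γ (g s) s := fun s =>
    (intervalIntegral.integral_hasDerivAt_right (hgc.intervalIntegrable _ _)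
      (hgc.stronglyMeasurableAtFilter _ _) hgc.continuousAt).const_add _
  have hxcd : ∀ s ∈ Icc (0 : ℝ) 1, HasDerivWithinAt (fun s => x (T * s)) (g s) (Icc 0 1) s := by
    intro s hs
    have h := HasDerivWithinAt.scomp s (hxd (T * s) (hmaps hs))
      (((hasDerivAt_id s).const_mul T).hasDerivWithinAt (s := Icc 0 1)) hmaps
    rw [hg_eq s hs]
    exact h.congr_deriv (by rw [mul_one])
  have hγx : ∀ s ∈ Icc (0 : ℝ) 1, γ s = x (T * s) :=
    eq_of_has_deriv_right_eq (f' := g) (fun s _ => (hγd s).hasDerivWithinAt)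
      (fun s hs => hasDerivWithinAt_Ici_of_Icc (hxcd s (Ico_subset_Icc_self hs)) hs)
      (fun s _ => (hγd s).continuousAt.continuousWithinAt)
      (fun s hs => (hxcd s hs).continuousWithinAt) (by simp [hγ])
  have hlen : curveLength q γ = T := by
    have : ∀ s ∈ uIcc (0 : ℝ) 1,
        √(∑ i, ∑ j, q (γ s) i j * deriv γ s i * deriv γ s j) = T := by
      intro s hs
      rw [uIcc_of_le zero_le_one] at hs
      have h := h1 (T * s) (hmaps hs)
      rw [hγx s hs, (hγd s).deriv, hg_eq s hs]
      have h2 : ∑ i, ∑ j, q (x (T * s)) i j * (T • v (T * s)) i * (T • v (T * s)) j =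
          T ^ 2 * metric q (x (T * s)) (v (T * s)) (v (T * s)) := by
        simp only [metric, Fin.sum_univ_two, PiLp.smul_apply, smul_eq_mul]
        ring
      rw [h2, h, mul_one, Real.sqrt_sq hT]
    rw [curveLength, intervalIntegral.integral_congr this]
    simp
  have hbdd : BddBelow {ℓ : ℝ | ∃ γ : ℝ → Plane, ContDiff ℝ 1 γ ∧
      (∀ t ∈ Icc (0 : ℝ) 1, γ t ∈ disk) ∧ γ 0 = x 0 ∧ γ 1 = x T ∧ ℓ = curveLength q γ} := by
    refine ⟨0, ?_⟩
    rintro _ ⟨γ, -, -, -, -, rfl⟩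
    exact intervalIntegral.integral_nonneg zero_le_one fun _ _ => Real.sqrt_nonneg _
  rw [riemDist]
  refine (csInf_le hbdd ⟨γ, ?_, fun s hs => ?_, ?_, ?_, rfl⟩).trans hlen.le
  · rw [contDiff_one_iff_deriv]
    refine ⟨fun s => (hγd s).differentiableAt, ?_⟩
    rwa [show deriv γ = g from funext fun s => (hγd s).deriv]
  · rw [hγx s hs]
    exact hx _ (hmaps hs)
  · simp [hγ]
  · rw [hγx 1 ⟨zero_le_one, le_rfl⟩, mul_one]

lemma IsRiemannianMetric.continuousOn_metric (hq : IsRiemannianMetric q) :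
    ContinuousOn (fun p : Plane × Plane => metric q p.1 p.2 p.2) (disk ×ˢ univ) := by
  have hc : ∀ i j, ContinuousOn (fun p : Plane × Plane => q p.1 i j) (disk ×ˢ univ) := fun i j =>
    (hq.smooth i j).continuousOn.comp continuousOn_fst fun p hp => hp.1
  unfold metric
  refine continuousOn_finsetSum _ fun i _ => continuousOn_finsetSum _ fun j _ => ?_
  exact ((hc i j).mul (by fun_prop)).mul (by fun_prop)

/-- Above a compact set, unit vectors are bounded. -/
lemma IsRiemannianMetric.exists_norm_le (hq : IsRiemannianMetric q) {C : Set Plane}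
    (hC : IsCompact C) (hCd : C ⊆ disk) :
    ∃ B, ∀ x ∈ C, ∀ v, metric q x v v = 1 → ‖v‖ ≤ B := by
  -- This is the trace of the inverse metric, which bounds `‖v‖²` for unit `v` because `tr q * q(v,
  -- v) - det q * ‖v‖²` is the sum of squares `‖q v‖²`.
  have hcont : ContinuousOn (fun x => (q x 0 0 + q x 1 1) / (q x).det) C :=
    (((hq.smooth 0 0).continuousOn.add (hq.smooth 1 1).continuousOn).div
      hq.contDiffOn_det.continuousOn fun x hx => (hq.det_pos hx).ne').mono hCd
  obtain ⟨B, hB⟩ := hC.exists_bound_of_continuousOn hcont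
  refine ⟨√B, fun x hx v hv => ?_⟩
  have hxd := hCd hx
  have hd := hq.det_pos hxd
  refine Real.le_sqrt_of_sq_le (le_trans ?_ ((le_abs_self _).trans (hB x hx)))
  rw [EuclideanSpace.real_norm_sq_eq, Fin.sum_univ_two, le_div_iff₀ hd, hq.det_eq hxd]
  rw [metric_eq, hq.symm hxd 1 0] at hv
  have : q x 0 0 + q x 1 1 - (v 0 ^ 2 + v 1 ^ 2) * (q x 0 0 * q x 1 1 - q x 0 1 ^ 2) =
      (q x 0 0 * v 0 + q x 0 1 * v 1) ^ 2 + (q x 0 1 * v 0 + q x 1 1 * v 1) ^ 2 := by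
    linear_combination (-(q x 0 0 + q x 1 1)) * hv
  nlinarith [sq_nonneg (q x 0 0 * v 0 + q x 0 1 * v 1), sq_nonneg (q x 0 1 * v 0 + q x 1 1 * v 1)]

/-- The set where the geodesics from `c` and their Jacobi fields remain up to the time `ρ`. -/
def jacobiRegion (q : Plane → Matrix (Fin 2) (Fin 2) ℝ) (c : Plane) (ρ : ℝ) : Set JacobiSpace :=
  {z | (z.1.1 ∈ disk ∧ riemDist q c z.1.1 ≤ ρ) ∧ metric q z.1.1 z.1.2 z.1.2 = 1 ∧
    ‖z.2‖ ≤ Real.exp ρ}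

lemma jacobiRegion_subset (c : Plane) (ρ : ℝ) : jacobiRegion q c ρ ⊆ jacobiDomain :=
  fun _ hz => ⟨⟨hz.1.1, mem_univ _⟩, mem_univ _⟩

lemma IsRiemannianMetric.isCompact_jacobiRegion (hq : IsRiemannianMetric q) {c : Plane} {R ρ : ℝ}
    (hR : IsDiskOfRadius q c R) (hρ : ρ < R) : IsCompact (jacobiRegion q c ρ) := by
  have hC := hR.isCompact_closedBall ρ hρ
  have hCd : {x ∈ disk | riemDist q c x ≤ ρ} ⊆ disk := fun x hx => hx.1
  obtain ⟨B, hB⟩ := hq.exists_norm_le hC hCd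
  have hK := (hC.prod (isCompact_closedBall (0 : Plane) B)).prod
    (isCompact_closedBall (0 : ℝ × ℝ) (Real.exp ρ))
  have hm : ContinuousOn (fun z : JacobiSpace => metric q z.1.1 z.1.2 z.1.2)
      (({x ∈ disk | riemDist q c x ≤ ρ} ×ˢ Metric.closedBall 0 B) ×ˢ
        Metric.closedBall 0 (Real.exp ρ)) :=
    hq.continuousOn_metric.comp continuousOn_fst fun z hz => ⟨hz.1.1.1, mem_univ _⟩
  refine hK.of_isClosed_subset
    ((?_ : jacobiRegion q c ρ = _) ▸ hm.preimage_isClosed_of_isClosed hK.isClosed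
      (isClosed_singleton (x := (1 : ℝ)))) ?_
  · ext z
    constructor
    · rintro ⟨h1, h2, h3⟩
      exact ⟨⟨⟨h1, mem_closedBall_zero_iff.2 (hB _ h1 _ h2)⟩, mem_closedBall_zero_iff.2 h3⟩, h2⟩
    · rintro ⟨⟨⟨h1, -⟩, h3⟩, h2⟩
      exact ⟨h1, h2, mem_closedBall_zero_iff.1 h3⟩
  · rintro z ⟨h1, h2, h3⟩
    exact ⟨⟨h1, mem_closedBall_zero_iff.2 (hB _ h1 _ h2)⟩, mem_closedBall_zero_iff.2 h3⟩

/-- This is the a priori bound: unit speed controls the distance to `c`, and the curvature bound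
controls the Jacobi field. -/
lemma IsSol.mem_jacobiRegion (hq : IsRiemannianMetric q)
    (hK : ∀ x ∈ disk, gaussCurvature q x ∈ Icc (-1) 0) {z : ℝ → JacobiSpace} {T ρ : ℝ}
    {c v : Plane} (hv : metric q c v v = 1) (hz : IsSol (jacobiField q) jacobiDomain z T)
    (h0 : z 0 = ((c, v), (0, 1))) (hT : T ∈ Icc 0 ρ) : z T ∈ jacobiRegion q c ρ := by
  have hTT : T ∈ Icc 0 T := ⟨hT.1, le_rfl⟩
  have hm := fun t (ht : t ∈ Icc 0 T) => hz.metric_eq_one hq (by rw [h0]; exact hv) ht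
  refine ⟨⟨hz.mem_disk hTT, ?_⟩, hm T hTT, ?_⟩
  · have := riemDist_le_of_unit_speed hT.1 (fun t ht => hz.mem_disk ht)
      (fun t ht => hz.deriv_pos ht) (fun t ht => (hz.deriv_vel ht).continuousWithinAt) hm
    rw [h0] at this
    exact this.trans hT.2
  · exact (hz.norm_jacobi_le hK (by rw [h0]) hTT).trans (Real.exp_le_exp.2 hT.2)

/-- In a disk of radius `R`, the geodesics from the center are defined up to the time `R`. -/
lemma exists_geodesic (hq : IsRiemannianMetric q)
    (hK : ∀ x ∈ disk, gaussCurvature q x ∈ Icc (-1) 0) {c v : Plane} {R : ℝ} (hR0 : 0 < R)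
    (hR : IsDiskOfRadius q c R) (hv : metric q c v v = 1) :
    ∃ z : ℝ → JacobiSpace, z 0 = ((c, v), (0, 1)) ∧
      ∀ ρ ∈ Ico 0 R, IsSol (jacobiField q) jacobiDomain z ρ := by
  refine exists_isSol_glue isOpen_jacobiDomain hq.contDiffOn_jacobiField hR0 fun ρ hρ => ?_
  refine exists_isSol_of_apriori isOpen_jacobiDomain hq.contDiffOn_jacobiField
    (hq.isCompact_jacobiRegion hR hρ.2) (jacobiRegion_subset c ρ) ?_ hρ.1
    fun T hT z hz h0 => hz.mem_jacobiRegion hq hK hv h0 hT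
  refine ⟨⟨hR.center_mem, ?_⟩, hv, ?_⟩
  -- On the degenerate interval `[0, 0]` any vector is a derivative, so the constant curve passes
  -- for one of unit speed and gives distance at most `0`.
  · exact (riemDist_le_of_unit_speed (q := q) (x := fun _ => c) (v := fun _ => v) le_rfl
      (fun _ _ => hR.center_mem) (fun t ht => by
        rw [Icc_self] at ht ⊢
        rw [mem_singleton_iff.1 ht]
        exact HasFDerivWithinAt.of_subsingleton subsingleton_singleton)
      continuousOn_const fun _ _ => hv).trans hρ.1
  · simp [Prod.norm_def, hρ.1]

end Polar

/-! ### Integrals over the angle -/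

section Integral

variable {f f' : ℝ → ℝ → ℝ} {a b R : ℝ}

lemma continuous_angle (hf : ContinuousOn (fun p : ℝ × ℝ => f p.1 p.2) (univ ×ˢ Ico 0 R)) {t : ℝ}
    (ht : t ∈ Ico 0 R) : Continuous fun θ => f θ t :=
  hf.comp_continuous (f := fun θ : ℝ => (θ, t)) (by fun_prop) fun _ => ⟨mem_univ _, ht⟩

lemma continuousOn_integral_angle
    (hf : ContinuousOn (fun p : ℝ × ℝ => f p.1 p.2) (univ ×ˢ Ico 0 R)) :
    ContinuousOn (fun t => ∫ θ in a..b, f θ t) (Ico 0 R) := by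
  intro t₀ ht₀
  obtain ⟨ρ, hρ, hρR⟩ := exists_between ht₀.2
  have h0ρ : 0 ≤ ρ := ht₀.1.trans hρ.le
  -- Clamping `t` to `[0, ρ]` makes the integrand continuous everywhere without changing it near
  -- `t₀` in `[0, R)`.
  have hcont : Continuous fun t => ∫ θ in a..b, f θ (projIcc 0 ρ h0ρ t) := by
    refine intervalIntegral.continuous_parametric_intervalIntegral_of_continuous' ?_ a b
    refine hf.comp_continuous (f := fun p : ℝ × ℝ => (p.2, (projIcc 0 ρ h0ρ p.1 : ℝ)))
      (continuous_snd.prodMk (continuous_subtype_val.comp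
        (continuous_projIcc.comp continuous_fst))) fun p => ⟨mem_univ _, ?_⟩
    exact ⟨(projIcc 0 ρ h0ρ p.1).2.1, (projIcc 0 ρ h0ρ p.1).2.2.trans_lt hρR⟩
  refine hcont.continuousWithinAt.congr_of_eventuallyEq ?_ ?_
  · filter_upwards [self_mem_nhdsWithin, nhdsWithin_le_nhds (gt_mem_nhds hρ)] with t ht htρ
    rw [projIcc_of_mem h0ρ ⟨ht.1, htρ.le⟩]
  · rw [projIcc_of_mem h0ρ ⟨ht₀.1, hρ.le⟩]

lemma hasDerivAt_integral_angle
    (hf : ContinuousOn (fun p : ℝ × ℝ => f p.1 p.2) (univ ×ˢ Ico 0 R))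
    (hf' : ContinuousOn (fun p : ℝ × ℝ => f' p.1 p.2) (univ ×ˢ Ico 0 R))
    (hd : ∀ θ, ∀ t ∈ Ioo 0 R, HasDerivAt (f θ) (f' θ t) t) {t : ℝ} (ht : t ∈ Ioo 0 R) :
    HasDerivAt (fun t => ∫ θ in a..b, f θ t) (∫ θ in a..b, f' θ t) t := by
  obtain ⟨ρ, hρ, hρR⟩ := exists_between ht.2
  have hK : IsCompact (uIcc a b ×ˢ Icc 0 ρ) := isCompact_uIcc.prod isCompact_Icc
  obtain ⟨B, hB⟩ := hK.exists_bound_of_continuousOn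
    (hf'.mono (prod_mono (subset_univ _) fun s hs => ⟨hs.1, hs.2.trans_lt hρR⟩))
  have hsub : ∀ s ∈ Ioo 0 ρ, s ∈ Ioo 0 R := fun s hs => ⟨hs.1, hs.2.trans hρR⟩
  refine (intervalIntegral.hasDerivAt_integral_of_dominated_loc_of_deriv_le (𝕜 := ℝ)
    (F := fun t θ => f θ t) (F' := fun t θ => f' θ t) (bound := fun _ => B)
    (Ioo_mem_nhds ht.1 hρ) ?_ ?_ ?_ ?_ intervalIntegrable_const ?_).2
  · filter_upwards [Ioo_mem_nhds ht.1 ht.2] with s hs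
    exact (continuous_angle hf (Ioo_subset_Ico_self hs)).aestronglyMeasurable
  · exact (continuous_angle hf (Ioo_subset_Ico_self ht)).intervalIntegrable _ _
  · exact (continuous_angle hf' (Ioo_subset_Ico_self ht)).aestronglyMeasurable
  · refine Eventually.of_forall fun θ hθ s hs => hB (θ, s) ⟨uIoc_subset_uIcc hθ, ?_⟩
    exact Ioo_subset_Icc_self hs
  · exact Eventually.of_forall fun θ _ s hs => hd θ s (hsub s hs)

end Integral

/-! ### The pencil of geodesics from the center -/

section Pencil

variable {q : Plane → Matrix (Fin 2) (Fin 2) ℝ} {u : Plane → ℝ} {c a : Plane} {R : ℝ}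

/-- The vector at angle `θ` with `a`. -/
noncomputable def dir (q : Plane → Matrix (Fin 2) (Fin 2) ℝ) (c a : Plane) (θ : ℝ) : Plane :=
  Real.cos θ • a + Real.sin θ • rot q c a

lemma IsRiemannianMetric.exists_unit (hq : IsRiemannianMetric q) (hc : c ∈ disk) :
    ∃ a, metric q c a a = 1 := by
  refine ⟨EuclideanSpace.single 0 (1 / √(q c 0 0)), ?_⟩
  have h := hq.diag_pos hc 0
  have hs := Real.sq_sqrt h.le
  have hs0 := (Real.sqrt_pos.2 h).ne'
  simp only [metric_eq, PiLp.single_apply]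
  simp only [reduceIte, one_ne_zero, mul_zero, add_zero]
  field_simp
  linear_combination -hs

lemma IsRiemannianMetric.metric_dir (hq : IsRiemannianMetric q) (hc : c ∈ disk)
    (ha : metric q c a a = 1) (θ : ℝ) : metric q c (dir q c a θ) (dir q c a θ) = 1 := by
  have h1 := hq.metric_rot hc a
  have h2 := hq.metric_rot_rot hc a
  have h3 := Real.sin_sq_add_cos_sq θ
  rw [ha] at h2
  simp only [metric_eq, dir, PiLp.add_apply, PiLp.smul_apply, smul_eq_mul, hq.symm hc 1 0] at *
  linear_combination Real.cos θ ^ 2 * ha + 2 * Real.cos θ * Real.sin θ * h1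
    + Real.sin θ ^ 2 * h2 + h3

lemma IsRiemannianMetric.hasDerivAt_dir (hq : IsRiemannianMetric q) (hc : c ∈ disk) (θ : ℝ) :
    HasDerivAt (dir q c a) (rot q c (dir q c a θ)) θ := by
  refine (((Real.hasDerivAt_cos θ).smul_const a).add
    ((Real.hasDerivAt_sin θ).smul_const (rot q c a))).congr_deriv ?_
  rw [dir, rot_add, rot_smul, rot_smul, hq.rot_rot hc]
  module

lemma dir_two_pi : dir q c a (2 * Real.pi) = dir q c a 0 := by simp [dir]

/-- The data of the unit speed geodesics from `c` and of the normal Jacobi fields along them. -/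
structure IsPencil (q : Plane → Matrix (Fin 2) (Fin 2) ℝ) (c a : Plane) (R : ℝ)
    (Z : ℝ → ℝ → JacobiSpace) : Prop where
  init_eq : ∀ θ, Z θ 0 = ((c, dir q c a θ), (0, 1))
  isSol : ∀ θ, ∀ ρ ∈ Ico 0 R, IsSol (jacobiField q) jacobiDomain (Z θ) ρ

variable {Z : ℝ → ℝ → JacobiSpace}

namespace IsPencil

lemma mem_domain (hZ : IsPencil q c a R Z) {θ t : ℝ} (ht : t ∈ Ico 0 R) : Z θ t ∈ jacobiDomain :=
  (hZ.isSol θ t ht).mem ⟨ht.1, le_rfl⟩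

lemma mem_disk (hZ : IsPencil q c a R Z) {θ t : ℝ} (ht : t ∈ Ico 0 R) : (Z θ t).1.1 ∈ disk :=
  (hZ.mem_domain ht).1.1

lemma metric_eq_one (hZ : IsPencil q c a R Z) (hq : IsRiemannianMetric q) (hc : c ∈ disk)
    (ha : metric q c a a = 1) {θ t : ℝ} (ht : t ∈ Ico 0 R) :
    metric q (Z θ t).1.1 (Z θ t).1.2 (Z θ t).1.2 = 1 :=
  (hZ.isSol θ t ht).metric_eq_one hq (by rw [hZ.init_eq]; exact hq.metric_dir hc ha θ)
    ⟨ht.1, le_rfl⟩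

lemma le_jacobi (hZ : IsPencil q c a R Z) (hK : ∀ x ∈ disk, gaussCurvature q x ∈ Icc (-1) 0)
    {θ t : ℝ} (ht : t ∈ Ico 0 R) : t ≤ (Z θ t).2.1 ∧ 1 ≤ (Z θ t).2.2 :=
  (hZ.isSol θ t ht).le_jacobi (fun x hx => (hK x hx).2) (by rw [hZ.init_eq]) ⟨ht.1, le_rfl⟩

lemma mem_region (hZ : IsPencil q c a R Z) (hq : IsRiemannianMetric q)
    (hK : ∀ x ∈ disk, gaussCurvature q x ∈ Icc (-1) 0) (hc : c ∈ disk)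
    (ha : metric q c a a = 1) {θ t ρ : ℝ} (hρ : ρ < R) (ht : t ∈ Icc 0 ρ) :
    Z θ t ∈ jacobiRegion q c ρ :=
  (hZ.isSol θ t ⟨ht.1, ht.2.trans_lt hρ⟩).mem_jacobiRegion hq hK (hq.metric_dir hc ha θ)
    (hZ.init_eq θ) ht

lemma continuousOn (hZ : IsPencil q c a R Z) (hq : IsRiemannianMetric q)
    (hK : ∀ x ∈ disk, gaussCurvature q x ∈ Icc (-1) 0) (hR : IsDiskOfRadius q c R)
    (ha : metric q c a a = 1) :
    ContinuousOn (fun p : ℝ × ℝ => Z p.1 p.2) (univ ×ˢ Ico 0 R) := by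
  rintro ⟨θ, t⟩ ⟨-, ht : t ∈ Ico 0 R⟩
  obtain ⟨ρ, hρ, hρR⟩ := exists_between ht.2
  have h0 : Continuous fun θ => Z θ 0 := by
    simp only [hZ.init_eq, dir]
    fun_prop
  have h := continuousOn_uncurry_isSol isOpen_jacobiDomain hq.contDiffOn_jacobiField
    (hq.isCompact_jacobiRegion hR hρR) (jacobiRegion_subset c ρ)
    (fun θ => hZ.isSol θ ρ ⟨ht.1.trans hρ.le, hρR⟩)
    (fun θ t ht => hZ.mem_region hq hK hR.center_mem ha hρR ht) h0
  refine (h (θ, t) ⟨mem_univ _, ht.1, hρ.le⟩).mono_of_mem_nhdsWithin ?_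
  filter_upwards [self_mem_nhdsWithin,
    nhdsWithin_le_nhds ((continuous_snd.tendsto (θ, t)).eventually (gt_mem_nhds hρ))] with p hp hpρ
  exact ⟨mem_univ _, hp.2.1, hpρ.le⟩

/-- By uniqueness the pencil closes up, so the boundary terms of an integral over the angle cancel.
-/
lemma eq_two_pi (hZ : IsPencil q c a R Z) (hq : IsRiemannianMetric q) {t : ℝ} (ht : t ∈ Ico 0 R) :
    Z (2 * Real.pi) t = Z 0 t :=
  (hZ.isSol _ t ht).eqOn isOpen_jacobiDomain hq.contDiffOn_jacobiField (hZ.isSol _ t ht)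
    (by rw [hZ.init_eq, hZ.init_eq, dir_two_pi]) ⟨ht.1, le_rfl⟩

/-- The angular derivative of the geodesics is the normal Jacobi field. -/
lemma hasDerivAt_angle (hZ : IsPencil q c a R Z) (hq : IsRiemannianMetric q)
    (hK : ∀ x ∈ disk, gaussCurvature q x ∈ Icc (-1) 0) (hR : IsDiskOfRadius q c R)
    (ha : metric q c a a = 1) (θ : ℝ) {t : ℝ} (ht : t ∈ Ico 0 R) :
    HasDerivAt (fun θ => (Z θ t).1) ((Z θ t).2.1 • rot q (Z θ t).1.1 (Z θ t).1.2,
      (Z θ t).2.2 • rot q (Z θ t).1.1 (Z θ t).1.2 - (Z θ t).2.1 •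
        conn q (Z θ t).1.1 (rot q (Z θ t).1.1 (Z θ t).1.2) (Z θ t).1.2) θ := by
  have hsol := hZ.isSol θ t ht
  refine hasDerivAt_isSol_param (F := geodesicField q) (Ω := disk ×ˢ univ)
    (C := Prod.fst '' jacobiRegion q c t) (ρ := t) (Z := fun θ t => (Z θ t).1)
    (ζ := fun t => ((Z θ t).2.1 • rot q (Z θ t).1.1 (Z θ t).1.2,
      (Z θ t).2.2 • rot q (Z θ t).1.1 (Z θ t).1.2 - (Z θ t).2.1 •
        conn q (Z θ t).1.1 (rot q (Z θ t).1.1 (Z θ t).1.2) (Z θ t).1.2))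
    (isOpen_disk.prod isOpen_univ) (hq.contDiffOn_geodesicField.of_le (by simp))
    ((hq.isCompact_jacobiRegion hR ht.2).image continuous_fst) ?_ ?_ ?_ ?_ ?_ ⟨ht.1, le_rfl⟩
  · rintro _ ⟨z, hz, rfl⟩
    exact (jacobiRegion_subset c t hz).1
  · intro θ s hs
    exact ⟨((hZ.isSol θ t ht).mem hs).1, hasDerivWithinAt_fst ((hZ.isSol θ t ht) s hs).2⟩
  · intro θ s hs
    exact mem_image_of_mem _ (hZ.mem_region hq hK hR.center_mem ha ht.2 hs)
  · simp only [hZ.init_eq]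
    refine ((hasDerivAt_const θ c).prodMk (hq.hasDerivAt_dir hR.center_mem θ)).congr_deriv ?_
    simp
  · intro s hs
    exact hq.hasDerivWithinAt_jacobi (x := fun t => (Z θ t).1.1) (v := fun t => (Z θ t).1.2)
      (J := fun t => (Z θ t).2.1) (P := fun t => (Z θ t).2.2) (hsol.mem_disk hs)
      (hsol.deriv_pos hs) (hsol.deriv_vel hs) (hsol.deriv_jacobi hs) (hsol.deriv_jacobi_deriv hs)
      (hZ.metric_eq_one hq hR.center_mem ha ⟨hs.1, hs.2.trans_lt ht.2⟩)

end IsPencil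

lemma exists_isPencil (hq : IsRiemannianMetric q)
    (hK : ∀ x ∈ disk, gaussCurvature q x ∈ Icc (-1) 0) (hR0 : 0 < R)
    (hR : IsDiskOfRadius q c R) (ha : metric q c a a = 1) : ∃ Z, IsPencil q c a R Z := by
  choose Z hZ0 hZ using fun θ =>
    exists_geodesic hq hK hR0 hR (hq.metric_dir hR.center_mem ha θ)
  exact ⟨Z, hZ0, hZ⟩

end Pencil

/-! ### The gradient estimate -/

section Estimate

variable {q : Plane → Matrix (Fin 2) (Fin 2) ℝ} {u : Plane → ℝ}

lemma continuousOn_du (hu : ContDiffOn ℝ ∞ u disk) :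
    ContinuousOn (fun p : Plane × Plane => du u p.1 p.2) (disk ×ˢ univ) := by
  have h : ∀ i, ContinuousOn (fun p : Plane × Plane => pd i u p.1) (disk ×ˢ univ) := fun i =>
    (contDiffOn_pd hu i).continuousOn.comp continuousOn_fst fun p hp => hp.1
  unfold du
  exact ((h 0).mul (by fun_prop)).add ((h 1).mul (by fun_prop))

lemma IsRiemannianMetric.continuousOn_hess (hq : IsRiemannianMetric q)
    (hu : ContDiffOn ℝ ∞ u disk) :
    ContinuousOn (fun p : Plane × Plane => hess q u p.1 p.2 p.2) (disk ×ˢ univ) := by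
  have hfst : ∀ f : Plane → ℝ, ContDiffOn ℝ ∞ f disk →
      ContinuousOn (fun p : Plane × Plane => f p.1) (disk ×ˢ univ) := fun f hf =>
    hf.continuousOn.comp continuousOn_fst fun p hp => hp.1
  unfold hess
  refine continuousOn_finsetSum _ fun i _ => continuousOn_finsetSum _ fun j _ => ?_
  refine (ContinuousOn.mul (ContinuousOn.sub ?_ ?_) (by fun_prop)).mul (by fun_prop)
  · exact hfst _ (contDiffOn_pd (contDiffOn_pd hu j) i)
  · exact continuousOn_finsetSum _ fun k _ =>
      (hfst _ (hq.contDiffOn_christoffel k i j)).mul (hfst _ (contDiffOn_pd hu k))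

/-- On a disk of radius `R` with curvature in `[-1, 0]`, the gradient of a function of Laplacian
`1` is somewhere at least as long as the value at `R` of the solution of the Riccati equation. -/
theorem exists_le_normDiff (hq : IsRiemannianMetric q) {c : Plane} {R : ℝ} (hR0 : 0 < R)
    (hR : IsDiskOfRadius q c R) (hu : ContDiffOn ℝ ∞ u disk)
    (hΔ : ∀ x ∈ disk, laplacian q u x = 1)
    (hK : ∀ x ∈ disk, gaussCurvature q x ∈ Icc (-1) 0) :
    ∃ x ∈ disk, riccatiSol R ≤ normDiff q u x := by
  by_contra! hlt
  have hc := hR.center_mem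
  obtain ⟨a, ha⟩ := hq.exists_unit hc
  obtain ⟨Z, hZ⟩ := exists_isPencil hq hK hR0 hR ha
  have hpi := Real.pi_pos
  have h2pi : (0 : ℝ) ≤ 2 * Real.pi := by positivity
  have hcomp : ∀ Φ : JacobiSpace → ℝ, ContinuousOn Φ jacobiDomain →
      ContinuousOn (fun p : ℝ × ℝ => Φ (Z p.1 p.2)) (univ ×ˢ Ico 0 R) := fun Φ hΦ =>
    hΦ.comp (hZ.continuousOn hq hK hR ha) fun p hp => hZ.mem_domain hp.2
  -- The length element, its derivatives, and the flux of the gradient.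
  set J : ℝ → ℝ → ℝ := fun θ t => (Z θ t).2.1 with hJdef
  set P : ℝ → ℝ → ℝ := fun θ t => (Z θ t).2.2 with hPdef
  set N : ℝ → ℝ → ℝ := fun θ t => -gaussCurvature q (Z θ t).1.1 * (Z θ t).2.1 with hNdef
  set F : ℝ → ℝ → ℝ := fun θ t => (Z θ t).2.1 * du u (Z θ t).1.1 (Z θ t).1.2 with hFdef
  set F' : ℝ → ℝ → ℝ := fun θ t => (Z θ t).2.2 * du u (Z θ t).1.1 (Z θ t).1.2 +
    (Z θ t).2.1 * hess q u (Z θ t).1.1 (Z θ t).1.2 (Z θ t).1.2 with hF'def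
  have hJc : ContinuousOn (fun p : ℝ × ℝ => J p.1 p.2) (univ ×ˢ Ico 0 R) :=
    hcomp (fun z => z.2.1) (by fun_prop)
  have hPc : ContinuousOn (fun p : ℝ × ℝ => P p.1 p.2) (univ ×ˢ Ico 0 R) :=
    hcomp (fun z => z.2.2) (by fun_prop)
  have hdu : ContinuousOn (fun z : JacobiSpace => du u z.1.1 z.1.2) jacobiDomain :=
    (continuousOn_du hu).comp continuousOn_fst fun z hz => hz.1
  have hhess : ContinuousOn (fun z : JacobiSpace => hess q u z.1.1 z.1.2 z.1.2) jacobiDomain :=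
    (hq.continuousOn_hess hu).comp continuousOn_fst fun z hz => hz.1
  have hKc : ContinuousOn (fun z : JacobiSpace => gaussCurvature q z.1.1) jacobiDomain :=
    hq.contDiffOn_gaussCurvature.continuousOn.comp
      (continuous_fst.comp continuous_fst).continuousOn fun z hz => hz.1.1
  have hNc : ContinuousOn (fun p : ℝ × ℝ => N p.1 p.2) (univ ×ˢ Ico 0 R) :=
    hcomp (fun z => -gaussCurvature q z.1.1 * z.2.1) (hKc.neg.mul (by fun_prop))
  have hFc : ContinuousOn (fun p : ℝ × ℝ => F p.1 p.2) (univ ×ˢ Ico 0 R) :=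
    hcomp (fun z => z.2.1 * du u z.1.1 z.1.2) (ContinuousOn.mul (by fun_prop) hdu)
  have hF'c : ContinuousOn (fun p : ℝ × ℝ => F' p.1 p.2) (univ ×ˢ Ico 0 R) :=
    hcomp (fun z => z.2.2 * du u z.1.1 z.1.2 + z.2.1 * hess q u z.1.1 z.1.2 z.1.2)
      ((ContinuousOn.mul (by fun_prop) hdu).add (ContinuousOn.mul (by fun_prop) hhess))
  have hint : ∀ f : ℝ → ℝ → ℝ, ContinuousOn (fun p : ℝ × ℝ => f p.1 p.2) (univ ×ˢ Ico 0 R) →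
      ∀ t ∈ Ico 0 R, IntervalIntegrable (fun θ => f θ t) MeasureTheory.volume 0 (2 * Real.pi) :=
    fun f hf t ht => (continuous_angle hf ht).intervalIntegrable _ _
  have hJd : ∀ θ, ∀ t ∈ Ioo 0 R, HasDerivAt (J θ) (P θ t) t := fun θ t ht => by
    obtain ⟨ρ, hρ, hρR⟩ := exists_between ht.2
    exact ((hZ.isSol θ ρ ⟨ht.1.le.trans hρ.le, hρR⟩).deriv_jacobi ⟨ht.1.le, hρ.le⟩).hasDerivAt
      (Icc_mem_nhds ht.1 hρ)
  have hPd : ∀ θ, ∀ t ∈ Ioo 0 R, HasDerivAt (P θ) (N θ t) t := fun θ t ht => by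
    obtain ⟨ρ, hρ, hρR⟩ := exists_between ht.2
    exact ((hZ.isSol θ ρ ⟨ht.1.le.trans hρ.le, hρR⟩).deriv_jacobi_deriv
      ⟨ht.1.le, hρ.le⟩).hasDerivAt (Icc_mem_nhds ht.1 hρ)
  have hFd : ∀ θ, ∀ t ∈ Ioo 0 R, HasDerivAt (F θ) (F' θ t) t := fun θ t ht => by
    obtain ⟨ρ, hρ, hρR⟩ := exists_between ht.2
    have hs := hZ.isSol θ ρ ⟨ht.1.le.trans hρ.le, hρR⟩
    have ht' : t ∈ Icc 0 ρ := ⟨ht.1.le, hρ.le⟩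
    exact (hasDerivWithinAt_mul_du (q := q) (x := fun t => (Z θ t).1.1)
      (v := fun t => (Z θ t).1.2) (J := fun t => (Z θ t).2.1) hu (hs.mem_disk ht')
      (hs.deriv_pos ht') (hs.deriv_vel ht') (hs.deriv_jacobi ht')).hasDerivAt
      (Icc_mem_nhds ht.1 hρ)
  -- The divergence theorem.
  have hdiv : ∀ t ∈ Ico 0 R,
      ∫ θ in (0 : ℝ)..2 * Real.pi, F' θ t = ∫ θ in (0 : ℝ)..2 * Real.pi, J θ t := by
    intro t ht
    -- With `N = rot v`, the derivative is `J * hess(N, N) - P * du v`; as the trace of the Hessian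
    -- is `1`, this is `J - F'`, and it integrates to `0` over a period.
    have hb : ∀ θ, HasDerivAt
        (fun θ => du u (Z θ t).1.1 (rot q (Z θ t).1.1 (Z θ t).1.2)) (J θ t - F' θ t) θ := by
      intro θ
      have hmem := hZ.mem_disk (θ := θ) ht
      have h := (hZ.hasDerivAt_angle hq hK hR ha θ ht).hasDerivWithinAt (s := univ)
      have h' := hq.hasDerivWithinAt_du_rot (x := fun θ => (Z θ t).1.1)
        (v := fun θ => (Z θ t).1.2) hu hmem (hasDerivWithinAt_fst h) (hasDerivWithinAt_snd h)
      refine (h'.hasDerivAt univ_mem).congr_deriv ?_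
      have hlap := hq.laplacian_eq (u := u) hmem (hZ.metric_eq_one hq hc ha ht)
      rw [hΔ _ hmem] at hlap
      simp only [hJdef, hF'def]
      linear_combination (-(Z θ t).2.1) * hlap
    have h := intervalIntegral.integral_eq_sub_of_hasDerivAt (a := 0) (b := 2 * Real.pi)
      (fun θ _ => hb θ) ((hint J hJc t ht).sub (hint F' hF'c t ht))
    rw [intervalIntegral.integral_sub (hint J hJc t ht) (hint F' hF'c t ht),
      hZ.eq_two_pi hq ht, sub_self] at h
    linarith
  have hJ0 : ∀ θ, J θ 0 = 0 := fun θ => by simp [hJdef, hZ.init_eq]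
  have hP0 : ∀ θ, P θ 0 = 1 := fun θ => by simp [hPdef, hZ.init_eq]
  have hJpos : ∀ θ, ∀ t ∈ Ico 0 R, 0 ≤ J θ t := fun θ t ht =>
    ht.1.trans (hZ.le_jacobi hK ht).1
  have hA : ∀ t ∈ Ioo 0 R, HasDerivAt (fun t => ∫ θ in (0 : ℝ)..2 * Real.pi, F θ t)
      (∫ θ in (0 : ℝ)..2 * Real.pi, J θ t) t := fun t ht =>
    (hasDerivAt_integral_angle hFc hF'c hFd ht).congr_deriv (hdiv t (Ioo_subset_Ico_self ht))
  have hL : ∀ t ∈ Ioo 0 R, HasDerivAt (fun t => ∫ θ in (0 : ℝ)..2 * Real.pi, J θ t)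
      (∫ θ in (0 : ℝ)..2 * Real.pi, P θ t) t := fun t ht =>
    hasDerivAt_integral_angle hJc hPc hJd ht
  have hm : ∀ t ∈ Ioo 0 R, HasDerivAt (fun t => ∫ θ in (0 : ℝ)..2 * Real.pi, P θ t)
      (∫ θ in (0 : ℝ)..2 * Real.pi, N θ t) t := fun t ht =>
    hasDerivAt_integral_angle hPc hNc hPd ht
  have hNJ : ∀ t ∈ Ioo 0 R, ∫ θ in (0 : ℝ)..2 * Real.pi, N θ t ≤
      ∫ θ in (0 : ℝ)..2 * Real.pi, J θ t := fun t ht => by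
    have ht' := Ioo_subset_Ico_self ht
    refine intervalIntegral.integral_mono_on h2pi (hint N hNc t ht') (hint J hJc t ht')
      fun θ _ => ?_
    have h1 := hJpos θ t ht'
    have h2 := (hK _ (hZ.mem_disk (θ := θ) ht')).1
    exact mul_le_of_le_one_left h1 (by linarith)
  -- The role of the area is played by the flux itself, of which only `A' = L` and `A 0 = 0` are
  -- needed. The bound `m ≤ 2π + A` holds since `A - m` is nondecreasing and starts at `-2π`.
  obtain ⟨r, hr, hrlt⟩ := exists_lt_area_div_length hR0
    (A := fun t => ∫ θ in (0 : ℝ)..2 * Real.pi, F θ t)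
    (L := fun t => ∫ θ in (0 : ℝ)..2 * Real.pi, J θ t)
    (m := fun t => ∫ θ in (0 : ℝ)..2 * Real.pi, P θ t)
    (continuousOn_integral_angle hFc) (continuousOn_integral_angle hJc)
    (by simp [hFdef, hZ.init_eq]) (by simp [hJ0]) hA hL
    (fun t ht => by
      have ht' := Ioo_subset_Ico_self ht
      have := intervalIntegral.integral_mono_on h2pi
        (intervalIntegrable_const (c := (1 : ℝ))) (hint P hPc t ht')
        fun θ _ => (hZ.le_jacobi hK ht').2
      simpa using this)
    (fun t ht => by
      have := nonneg_of_hasDerivAt_nonneg (R := R)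
        (f := fun t => (∫ θ in (0 : ℝ)..2 * Real.pi, F θ t) -
          (∫ θ in (0 : ℝ)..2 * Real.pi, P θ t) + 2 * Real.pi)
        (((continuousOn_integral_angle hFc).sub (continuousOn_integral_angle hPc)).add
          continuousOn_const)
        (by simp [hFdef, hZ.init_eq, hP0])
        (fun t ht => ((hA t ht).sub (hm t ht)).add_const _)
        (fun t ht => sub_nonneg.2 (hNJ t ht)) ht
      linarith)
  have hr' := Ioo_subset_Ico_self hr
  -- The flux density is at most `J` times the norm of the gradient, which is assumed to be below
  -- `riccatiSol R`.
  refine absurd hrlt (not_lt.2 ?_)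
  rw [← intervalIntegral.integral_const_mul]
  refine intervalIntegral.integral_mono_on h2pi (hint F hFc r hr')
    ((hint J hJc r hr').const_mul _) fun θ _ => ?_
  have hmem := hZ.mem_disk (θ := θ) hr'
  have h1 := (le_abs_self _).trans
    ((hq.abs_du_le_normDiff (u := u) hmem (hZ.metric_eq_one hq hc ha hr')).trans (hlt _ hmem).le)
  rw [mul_comm (riccatiSol R)]
  exact mul_le_mul_of_nonneg_left h1 (hJpos θ r hr')

end Estimate

end RDisk

theorem lemma6p2 :
    ∃ y φ : ℝ → ℝ,
      -- `y` is the solution of the Riccati equation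
      RDisk.IsRiccatiSolution y ∧
      (∀ z : ℝ → ℝ, RDisk.IsRiccatiSolution z → EqOn z y (Ici 0)) ∧
      -- `φ : [0, 1) → [0, ∞)` is the inverse of `y : [0, ∞) → [0, 1)`
      MapsTo y (Ici 0) (Ico 0 1) ∧ MapsTo φ (Ico 0 1) (Ici 0) ∧
      InvOn φ y (Ici 0) (Ico 0 1) ∧
      ContinuousOn φ (Ico 0 1) ∧ StrictMonoOn φ (Ico 0 1) ∧ φ 0 = 0 ∧
      Tendsto φ (𝓝[<] 1) atTop ∧
      -- the estimate
      ∀ δ ∈ Ico (0 : ℝ) 1, ∀ (q : RDisk.Plane → Matrix (Fin 2) (Fin 2) ℝ) (c : RDisk.Plane)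
        (u : RDisk.Plane → ℝ),
        RDisk.IsRiemannianMetric q →
        RDisk.IsDiskOfRadius q c (φ δ) →
        ContDiffOn ℝ ∞ u RDisk.disk →
        (∀ x ∈ RDisk.disk, RDisk.laplacian q u x = 1) →
        (∀ x ∈ RDisk.disk, RDisk.gaussCurvature q x ∈ Icc (-1) 0) →
        ∃ x ∈ RDisk.disk, δ ≤ RDisk.normDiff q u x := by
  refine ⟨RDisk.riccatiSol, RDisk.riccatiInv, RDisk.isRiccatiSolution_riccatiSol,
    fun z hz => RDisk.isRiccatiSolution_riccatiSol.eqOn hz,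
    fun r hr => ⟨RDisk.riccatiSol_nonneg hr, RDisk.riccatiSol_lt_one hr⟩,
    fun δ hδ => RDisk.riccatiInv_mem hδ, RDisk.invOn_riccatiInv, RDisk.continuousOn_riccatiInv,
    RDisk.strictMonoOn_riccatiInv, RDisk.riccatiInv_zero, RDisk.tendsto_riccatiInv, ?_⟩
  intro δ hδ q c u hq hR hu hΔ hK
  rcases (mem_Ici.1 (RDisk.riccatiInv_mem hδ)).eq_or_lt with h0 | h0
  -- Radius `0` means `δ = 0`, and then the nonnegativity of the norm is enough.
  · refine ⟨c, hR.center_mem, ?_⟩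
    rw [← RDisk.riccatiSol_riccatiInv hδ, ← h0, RDisk.riccatiSol_zero]
    exact Real.sqrt_nonneg _
  · obtain ⟨x, hx, h⟩ := RDisk.exists_le_normDiff hq h0 hR hu hΔ hK
    rw [RDisk.riccatiSol_riccatiInv hδ] at h
    exact ⟨x, hx, h⟩
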